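/- Work in a space $\mathbb E$ of points, equipped with straight lines, planes, betweenness, and congruence of segments and of angles, that satisfies the axioms of incidence, order and congruence of Euclidean geometry (absolute geometry: neither continuity nor the parallel axiom is assumed; the axioms are the classical ones of Hilbert, in space). Segments have two distinct ending points. For sets $S,T$ that are both straight lines, both planes, or both the whole space, a mapping $f\colon S\to T$ is called a congruent translation if for any two distinct points $X,Y\in S$ the points $f(X),f(Y)$ are distinct and $[f(X)f(Y)]\cong[XY]$. A line $a$ on a plane $\alpha$ divides $\alpha\setminus a$ into two open half-planes, and a plane $\alpha$ divides $\mathbb E\setminus\alpha$ into two open half-spaces: the classes of points whose connecting segments do not meet $a$ (respectively $\alpha$). (1) Let $a$ be a straight line on a plane $\alpha$, dividing it into the two half-planes $a_+$ and $a_-$, and let $b$ be a straight line on a plane $\beta$, dividing it into the two half-planes $b_+$ and $b_-$. Then every congruent translation $f\colon a\to b$ has a unique extension to a congruent translation $F\colon\alpha\to\beta$ such that $F(a_+)=b_+$ and $F(a_-)=b_-$. (2) Let $\alpha$ be a plane dividing the space into the two half-spaces $\alpha_+$ and $\alpha_-$, and let $\beta$ be a plane dividing the space into the two half-spaces $\beta_+$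 and $\beta_-$. Then every congruent translation $f\colon\alpha\to\beta$ has a unique extension to a congruent translation $F\colon\mathbb E\to\mathbb E$ such that $F(\alpha_+)=\beta_+$ and $F(\alpha_-)=\beta_-$. -/

import Mathlib

/-- The primitive notions of synthetic space geometry: which sets of points are straight lines,
which are planes, the relation "the second point lies between the first and the third", and the
two congruence relations, for segments and for angles (both of which are sets of points). -/
class SpacePrimitives (E : Type*) where
  IsLine : Set E → Prop
  IsPlane : Set E → Prop
  Btw : E → E → E → Prop
  SegCong : Set E → Set E → Prop
  AngCong : Set E → Set E → Prop

namespace SpacePrimitives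

variable {E : Type*} [SpacePrimitives E]

/-- The three points lie on one straight line. -/
def Collinear (A B C : E) : Prop := ∃ l : Set E, IsLine l ∧ A ∈ l ∧ B ∈ l ∧ C ∈ l

/-- The four points lie on one plane. -/
def Coplanar (A B C D : E) : Prop :=
  ∃ α : Set E, IsPlane α ∧ A ∈ α ∧ B ∈ α ∧ C ∈ α ∧ D ∈ α

/-- The straight line `AB` (for `A ≠ B`). -/
def lineThrough (A B : E) : Set E := {X | ∃ l : Set E, IsLine l ∧ A ∈ l ∧ B ∈ l ∧ X ∈ l}

/-- The segment `[AB]`: its ending points and all points between them. -/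
def seg (A B : E) : Set E := {X | X = A ∨ X = B ∨ Btw A X B}

/-- The ray `[OA⟩` (for `A ≠ O`): the points of the line `OA` that are not beyond `O`. -/
def ray (O A : E) : Set E := {X | X = O ∨ X = A ∨ Btw O X A ∨ Btw O A X}

/-- The open half-plane of the plane `α` bounded by the line `a ⊆ α` that contains the point
`A ∈ α \ a`: the class of `A` for the relation "the connecting segment has no point in common
with `a`" on `α \ a`. -/
def halfPlaneOf (α a : Set E) (A : E) : Set E := {X | X ∈ α ∧ X ∉ a ∧ Disjoint (seg A X) a}

/-- `H` is one of the open half-planes into which the line `a` divides the plane `α`. -/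
def IsHalfPlane (α a H : Set E) : Prop := ∃ A : E, A ∈ α ∧ A ∉ a ∧ H = halfPlaneOf α a A

/-- The open half-space bounded by the plane `α` that contains the point `A ∉ α`. -/
def halfSpaceOf (α : Set E) (A : E) : Set E := {X | X ∉ α ∧ Disjoint (seg A X) α}

/-- `H` is one of the open half-spaces into which the plane `α` divides the space. -/
def IsHalfSpace (α H : Set E) : Prop := ∃ A : E, A ∉ α ∧ H = halfSpaceOf α A

/-- The angle `∠ A O B` (for `A`, `O`, `B` not on one line): in the plane of the three points, the
intersection of the closed half-plane bounded by the line `OA` that contains `B` with the closed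
half-plane bounded by the line `OB` that contains `A`. -/
def angle (A O B : E) : Set E :=
  {X | ∃ α : Set E, IsPlane α ∧ A ∈ α ∧ O ∈ α ∧ B ∈ α ∧
    X ∈ halfPlaneOf α (lineThrough O A) B ∪ lineThrough O A ∧
    X ∈ halfPlaneOf α (lineThrough O B) A ∪ lineThrough O B}

end SpacePrimitives

open SpacePrimitives in
/-- A space of absolute geometry: the axioms of incidence, of order and of congruence.
Segments are always understood to have two distinct ending points, and angles to have sides that
do not lie on one line. -/
class AbsoluteSpace (E : Type*) extends SpacePrimitives E where
  /- Incidence. -/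
  line_two_points : ∀ l : Set E, IsLine l → ∃ A ∈ l, ∃ B ∈ l, A ≠ B
  line_unique : ∀ A B : E, A ≠ B → ∃! l : Set E, IsLine l ∧ A ∈ l ∧ B ∈ l
  exists_triangle : ∃ A B C : E, A ≠ B ∧ A ≠ C ∧ B ≠ C ∧ ¬ Collinear A B C
  plane_unique : ∀ A B C : E, ¬ Collinear A B C →
    ∃! α : Set E, IsPlane α ∧ A ∈ α ∧ B ∈ α ∧ C ∈ α
  plane_nonempty : ∀ α : Set E, IsPlane α → α.Nonempty
  line_subset_plane : ∀ a α : Set E, IsLine a → IsPlane α →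
    ∀ A B : E, A ≠ B → A ∈ a → B ∈ a → A ∈ α → B ∈ α → a ⊆ α
  planes_meet : ∀ α β : Set E, IsPlane α → IsPlane β → α ≠ β → (α ∩ β).Nonempty →
    ∃ A ∈ α ∩ β, ∃ B ∈ α ∩ β, A ≠ B
  exists_tetrahedron : ∃ A B C D : E, ¬ Coplanar A B C D
  /- Order. Betweenness is a relation between three distinct points of one straight line. -/
  btw_distinct_collinear : ∀ A B C : E, Btw A B C →
    A ≠ B ∧ B ≠ C ∧ A ≠ C ∧ Collinear A B C
  btw_symm : ∀ A B C : E, Btw A B C → Btw C B A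
  btw_extend : ∀ A B : E, A ≠ B → ∃ C : E, Btw A B C
  btw_at_most_one : ∀ A B C : E, ¬ (Btw A B C ∧ Btw B C A) ∧
    ¬ (Btw B C A ∧ Btw C A B) ∧ ¬ (Btw A B C ∧ Btw C A B)
  pasch : ∀ α a : Set E, IsPlane α → IsLine a → a ⊆ α →
    ∀ A B C : E, A ∈ α → B ∈ α → C ∈ α → ¬ Collinear A B C →
      A ∉ a → B ∉ a → C ∉ a → (∃ X ∈ a, Btw A X B) →
      (∃ X ∈ a, Btw A X C) ∨ (∃ X ∈ a, Btw B X C)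
  /- Congruence of segments. -/
  segCong_refl : ∀ A B : E, A ≠ B → SegCong (seg A B) (seg A B)
  segCong_layoff : ∀ A B C P : E, A ≠ B → C ≠ P →
    ∃! D : E, D ∈ ray C P ∧ D ≠ C ∧ SegCong (seg A B) (seg C D)
  segCong_trans : ∀ A B C D K L : E, A ≠ B → C ≠ D → K ≠ L →
    SegCong (seg A B) (seg C D) → SegCong (seg C D) (seg K L) → SegCong (seg A B) (seg K L)
  segCong_add : ∀ A B C K L M : E, Btw A B C → Btw K L M →
    SegCong (seg A B) (seg K L) → SegCong (seg B C) (seg L M) → SegCong (seg A C) (seg K M)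
  segCong_sub : ∀ A B C K L M : E, Btw A B C → Btw K L M →
    SegCong (seg A B) (seg K L) → SegCong (seg A C) (seg K M) → SegCong (seg B C) (seg L M)
  /- Congruence of angles. -/
  angCong_refl : ∀ A O B : E, ¬ Collinear A O B → AngCong (angle A O B) (angle A O B)
  /- In a given half-plane `H` there is exactly one ray `n = [QN⟩` that forms with a given ray
  `[QM⟩` of the boundary line an angle to which `∠ A O B` is congruent. -/
  angCong_layoff : ∀ A O B : E, ¬ Collinear A O B →
    ∀ α a H : Set E, IsPlane α → IsLine a → a ⊆ α → IsHalfPlane α a H →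
    ∀ Q M : E, Q ∈ a → M ∈ a → Q ≠ M →
      ∃! n : Set E, ∃ N ∈ H, n = ray Q N ∧ AngCong (angle A O B) (angle M Q N)
  angCong_sas : ∀ A B C A' B' C' : E, ¬ Collinear A B C → ¬ Collinear A' B' C' →
    SegCong (seg A B) (seg A' B') → SegCong (seg A C) (seg A' C') →
    AngCong (angle B A C) (angle B' A' C') →
    AngCong (angle A B C) (angle A' B' C') ∧ AngCong (angle A C B) (angle A' C' B')

namespace AbsoluteSpace

variable {E : Type*} [AbsoluteSpace E]

open SpacePrimitives

/-- A mapping `f : S → T` (of a line to a line, or of a plane to a plane) is a congruent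
translation: for any two points `X`, `Y` of `S` the segment `[f(X)f(Y)]` is a segment congruent
to `[XY]`. -/
def IsCongruentTranslation {S T : Set E} (f : S → T) : Prop :=
  ∀ X Y : S, X ≠ Y → f X ≠ f Y ∧
    SegCong (seg (f X : E) (f Y : E)) (seg (X : E) (Y : E))

/-- A mapping of the whole space to itself is a congruent translation. -/
def IsSpaceCongruentTranslation (F : E → E) : Prop :=
  ∀ X Y : E, X ≠ Y → F X ≠ F Y ∧ SegCong (seg (F X) (F Y)) (seg X Y)

/-- The image, as a set of points, of `P ⊆ S` under a mapping `F : S → T`. -/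
def imageOf {S T : Set E} (F : S → T) (P : Set E) : Set E :=
  {Y | ∃ X : S, (X : E) ∈ P ∧ (F X : E) = Y}

end AbsoluteSpace

namespace AbsoluteSpace

open SpacePrimitives

variable {E : Type*} [AbsoluteSpace E]

/-! ### Incidence -/

/-! Congruence of segments is encoded in the class `d A B`, so that a congruent translation is a map
preserving `d` (`IsoMap`). Betweenness can be read off from distances: `btw_of_d` proves this with
isosceles triangles, without a triangle inequality. Hence such maps preserve order and carry lines
into lines.

From a line to a plane: a point X off a must go to the point X' on the prescribed side of b that has
the same angles and distances to f(a) as X has to a (`Match`). Laying off one angle and one distance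
produces X', and SAS together with supplementary angles gives the rest (`match_of_angle`). Distances
between two such points are preserved: if a separates them, prolong the segment from one image
through the image of the crossing point (`match_opp`); otherwise replace one of them by a point
beyond a and use SAS (`match_same`). Uniqueness holds because a point of a plane is determined by
its side of a line and its distances from that line (`eq_of_d_plane`).

From a plane to the space: the planar extension yields reflections, and from them the five segments
property (`five_segment`). Therefore equidistant sets are flat, and distances from three
non-collinear points control those from their whole plane. The main construction is the image of one
point off the plane (`exists_match_space`); it is found in the plane of points equidistant from two
points symmetric about a foot of a perpendicular. Preservation of distances then follows the planar
pattern, with `five_segment` in place of SAS, and uniqueness (`eq_of_d_space`) reduces to a plane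
section. Surjectivity turns inclusions between sides into equalities. -/

theorem line_ext {l m : Set E} (hl : IsLine l) (hm : IsLine m) {A B : E} (hAl : A ∈ l)
    (hBl : B ∈ l) (hAm : A ∈ m) (hBm : B ∈ m) (h : A ≠ B) : l = m :=
  (line_unique A B h).unique ⟨hl, hAl, hBl⟩ ⟨hm, hAm, hBm⟩

theorem line_inter {l m : Set E} (hl : IsLine l) (hm : IsLine m) (hlm : l ≠ m) {A B : E}
    (hAl : A ∈ l) (hAm : A ∈ m) (hBl : B ∈ l) (hBm : B ∈ m) : A = B := by
  by_contra h
  exact hlm (line_ext hl hm hAl hBl hAm hBm h)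

theorem exists_line {A B : E} (h : A ≠ B) : ∃ l : Set E, IsLine l ∧ A ∈ l ∧ B ∈ l :=
  (line_unique A B h).exists

theorem exists_notMem_line {l : Set E} (hl : IsLine l) : ∃ X, X ∉ l := by
  obtain ⟨A, B, C, -, -, -, h⟩ := exists_triangle (E := E)
  by_contra! hc
  exact h ⟨l, hl, hc A, hc B, hc C⟩

theorem exists_line_through (A : E) : ∃ l : Set E, IsLine l ∧ A ∈ l := by
  obtain ⟨P, Q, R, h, -, -, -⟩ := exists_triangle (E := E)
  by_cases hA : A = P
  · obtain ⟨l, hl, h1, h2⟩ := exists_line h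
    exact ⟨l, hl, hA ▸ h1⟩
  · obtain ⟨l, hl, h1, h2⟩ := exists_line hA
    exact ⟨l, hl, h1⟩

theorem exists_ne_mem {l : Set E} (hl : IsLine l) (A : E) : ∃ B ∈ l, B ≠ A := by
  obtain ⟨P, hP, Q, hQ, h⟩ := line_two_points l hl
  by_cases hA : P = A
  · exact ⟨Q, hQ, fun h' => h (hA.trans h'.symm)⟩
  · exact ⟨P, hP, hA⟩

theorem isLine_lineThrough {A B : E} (h : A ≠ B) : IsLine (lineThrough A B) := by
  obtain ⟨l, hl, hA, hB⟩ := exists_line h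
  have : lineThrough A B = l := by
    ext X
    constructor
    · rintro ⟨m, hm, h1, h2, h3⟩
      rwa [line_ext hl hm hA hB h1 h2 h]
    · intro hX
      exact ⟨l, hl, hA, hB, hX⟩
  rwa [this]

theorem left_mem_lineThrough (A B : E) : A ∈ lineThrough A B := by
  by_cases h : A = B
  · subst h
    obtain ⟨l, hl, hA⟩ := exists_line_through A
    exact ⟨l, hl, hA, hA, hA⟩
  · obtain ⟨l, hl, hA, hB⟩ := exists_line h
    exact ⟨l, hl, hA, hB, hA⟩

theorem lineThrough_comm (A B : E) : lineThrough A B = lineThrough B A := by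
  ext X
  constructor <;> rintro ⟨l, hl, hA, hB, hX⟩ <;> exact ⟨l, hl, hB, hA, hX⟩

theorem right_mem_lineThrough (A B : E) : B ∈ lineThrough A B :=
  lineThrough_comm B A ▸ left_mem_lineThrough B A

theorem eq_lineThrough {l : Set E} (hl : IsLine l) {A B : E} (h : A ≠ B) (hA : A ∈ l)
    (hB : B ∈ l) : l = lineThrough A B :=
  line_ext hl (isLine_lineThrough h) hA hB (left_mem_lineThrough A B) (right_mem_lineThrough A B) h

theorem collinear_iff_mem {l : Set E} (hl : IsLine l) {A B C : E} (h : A ≠ B) (hA : A ∈ l)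
    (hB : B ∈ l) : Collinear A B C ↔ C ∈ l := by
  constructor
  · rintro ⟨m, hm, h1, h2, h3⟩
    rwa [line_ext hl hm hA hB h1 h2 h]
  · exact fun hC => ⟨l, hl, hA, hB, hC⟩

theorem collinear_swap {A B C : E} (h : Collinear A B C) : Collinear B A C := by
  obtain ⟨l, hl, hA, hB, hC⟩ := h
  exact ⟨l, hl, hB, hA, hC⟩

theorem collinear_rotate {A B C : E} (h : Collinear A B C) : Collinear B C A := by
  obtain ⟨l, hl, hA, hB, hC⟩ := h
  exact ⟨l, hl, hB, hC, hA⟩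

theorem collinear_self (A B : E) : Collinear A A B := by
  obtain ⟨l, hl, hA, hB, hX⟩ := left_mem_lineThrough A B
  exact ⟨l, hl, hA, hA, hB⟩

theorem ne_of_not_collinear {A B C : E} (h : ¬ Collinear A B C) : A ≠ B ∧ B ≠ C ∧ A ≠ C := by
  refine ⟨?_, ?_, ?_⟩ <;> rintro rfl
  · exact h (collinear_self _ _)
  · exact h (collinear_rotate (collinear_rotate (collinear_self _ _)))
  · exact h (collinear_rotate (collinear_self _ _))

/-- The points `X`, `Y` are separated by the set `S`: a point of `S` lies between them. -/
def Opp (S : Set E) (A B : E) : Prop := ∃ X ∈ S, Btw A X B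

theorem Opp.symm {S : Set E} {A B : E} (h : Opp S A B) : Opp S B A := by
  obtain ⟨X, hX, h⟩ := h
  exact ⟨X, hX, btw_symm _ _ _ h⟩

theorem opp_comm {S : Set E} {A B : E} : Opp S A B ↔ Opp S B A := ⟨Opp.symm, Opp.symm⟩

theorem _root_.SpacePrimitives.Btw.symm {A B C : E} (h : Btw A B C) : Btw C B A := btw_symm _ _ _ h

theorem _root_.SpacePrimitives.Btw.ne {A B C : E} (h : Btw A B C) : A ≠ B ∧ B ≠ C ∧ A ≠ C :=
  let h' := btw_distinct_collinear A B C h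
  ⟨h'.1, h'.2.1, h'.2.2.1⟩

theorem _root_.SpacePrimitives.Btw.col {A B C : E} (h : Btw A B C) : Collinear A B C :=
  (btw_distinct_collinear A B C h).2.2.2

theorem _root_.SpacePrimitives.Btw.not1 {A B C : E} (h : Btw A B C) : ¬ Btw B C A :=
  fun h' => (btw_at_most_one A B C).1 ⟨h, h'⟩

theorem _root_.SpacePrimitives.Btw.not2 {A B C : E} (h : Btw A B C) : ¬ Btw B A C :=
  fun h' => (btw_at_most_one A B C).2.2 ⟨h, h'.symm⟩

theorem _root_.SpacePrimitives.Btw.mem_mid {l : Set E} (hl : IsLine l) {A B C : E}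
    (h : Btw A B C) (hA : A ∈ l)
    (hC : C ∈ l) : B ∈ l :=
  (collinear_iff_mem hl h.ne.2.2 hA hC).1
    (collinear_rotate (collinear_rotate (collinear_swap (collinear_rotate h.col))))

theorem _root_.SpacePrimitives.Btw.mem_right {l : Set E} (hl : IsLine l) {A B C : E}
    (h : Btw A B C) (hA : A ∈ l)
    (hB : B ∈ l) : C ∈ l :=
  (collinear_iff_mem hl h.ne.1 hA hB).1 h.col

theorem _root_.SpacePrimitives.Btw.mem_left {l : Set E} (hl : IsLine l) {A B C : E}
    (h : Btw A B C) (hB : B ∈ l)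
    (hC : C ∈ l) : A ∈ l :=
  h.symm.mem_right hl hC hB

theorem exists_plane {A B C : E} (h : ¬ Collinear A B C) :
    ∃ α : Set E, IsPlane α ∧ A ∈ α ∧ B ∈ α ∧ C ∈ α :=
  (plane_unique A B C h).exists

theorem plane_ext {α β : Set E} (hα : IsPlane α) (hβ : IsPlane β) {A B C : E}
    (h : ¬ Collinear A B C) (h1 : A ∈ α) (h2 : B ∈ α) (h3 : C ∈ α) (h4 : A ∈ β) (h5 : B ∈ β)
    (h6 : C ∈ β) : α = β :=
  (plane_unique A B C h).unique ⟨hα, h1, h2, h3⟩ ⟨hβ, h4, h5, h6⟩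

theorem line_subset {a α : Set E} (ha : IsLine a) (hα : IsPlane α) {A B : E} (h : A ≠ B)
    (h1 : A ∈ a) (h2 : B ∈ a) (h3 : A ∈ α) (h4 : B ∈ α) : a ⊆ α :=
  line_subset_plane a α ha hα A B h h1 h2 h3 h4

theorem exists_plane_line {a : Set E} (ha : IsLine a) {X : E} (hX : X ∉ a) :
    ∃ α : Set E, IsPlane α ∧ a ⊆ α ∧ X ∈ α := by
  obtain ⟨A, hA, B, hB, h⟩ := line_two_points a ha
  have hn : ¬ Collinear A B X := fun hc => hX ((collinear_iff_mem ha h hA hB).1 hc)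
  obtain ⟨α, hα, h1, h2, h3⟩ := exists_plane hn
  exact ⟨α, hα, line_subset ha hα h hA hB h1 h2, h3⟩

theorem plane_ext_line {a α β : Set E} (ha : IsLine a) (hα : IsPlane α) (hβ : IsPlane β)
    {X : E} (hX : X ∉ a) (h1 : a ⊆ α) (h2 : a ⊆ β) (h3 : X ∈ α) (h4 : X ∈ β) : α = β := by
  obtain ⟨A, hA, B, hB, h⟩ := line_two_points a ha
  have hn : ¬ Collinear A B X := fun hc => hX ((collinear_iff_mem ha h hA hB).1 hc)
  exact plane_ext hα hβ hn (h1 hA) (h1 hB) h3 (h2 hA) (h2 hB) h4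

theorem exists_notMem_plane {α : Set E} (hα : IsPlane α) : ∃ X, X ∉ α := by
  obtain ⟨A, B, C, D, h⟩ := exists_tetrahedron (E := E)
  by_contra! hc
  exact h ⟨α, hα, hc A, hc B, hc C, hc D⟩

/-- Two distinct planes with a common point meet in a line. -/
theorem exists_inter_line {α β : Set E} (hα : IsPlane α) (hβ : IsPlane β) (h : α ≠ β) {P : E}
    (h1 : P ∈ α) (h2 : P ∈ β) :
    ∃ l : Set E, IsLine l ∧ P ∈ l ∧ l ⊆ α ∧ l ⊆ β ∧ ∀ X, X ∈ α → X ∈ β → X ∈ l := by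
  obtain ⟨A, hA, B, hB, hAB⟩ := planes_meet α β hα hβ h ⟨P, h1, h2⟩
  obtain ⟨l, hl, hAl, hBl⟩ := exists_line hAB
  have s1 := line_subset hl hα hAB hAl hBl hA.1 hB.1
  have s2 := line_subset hl hβ hAB hAl hBl hA.2 hB.2
  have key : ∀ X, X ∈ α → X ∈ β → X ∈ l := by
    intro X h3 h4
    by_contra hX
    exact h (plane_ext_line hl hα hβ hX s1 s2 h3 h4)
  exact ⟨l, hl, key P h1 h2, s1, s2, key⟩

/-- Every plane contains two distinct lines with a common point. -/
theorem exists_lines_in_plane {α : Set E} (hα : IsPlane α) :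
    ∃ l m : Set E, IsLine l ∧ IsLine m ∧ l ≠ m ∧ l ⊆ α ∧ m ⊆ α ∧ ∃ P ∈ l, P ∈ m := by
  -- Planes are only assumed nonempty, so the two lines are cut out of α by two planes γ, δ through
  -- a line k that leaves α at P.
  obtain ⟨P, hP⟩ := plane_nonempty α hα
  obtain ⟨Q, hQ⟩ := exists_notMem_plane hα
  have hPQ : P ≠ Q := fun h => hQ (h ▸ hP)
  obtain ⟨k, hk, hPk, hQk⟩ := exists_line hPQ
  obtain ⟨R, hR⟩ := exists_notMem_line hk
  obtain ⟨γ, hγ, hkγ, hRγ⟩ := exists_plane_line hk hR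
  obtain ⟨S, hS⟩ := exists_notMem_plane hγ
  have hSk : S ∉ k := fun h => hS (hkγ h)
  obtain ⟨δ, hδ, hkδ, hSδ⟩ := exists_plane_line hk hSk
  have n1 : α ≠ γ := by rintro rfl; exact hQ (hkγ hQk)
  have n2 : α ≠ δ := by rintro rfl; exact hQ (hkδ hQk)
  obtain ⟨l, hl, hPl, hlα, hlγ, -⟩ := exists_inter_line hα hγ n1 hP (hkγ hPk)
  obtain ⟨m, hm, hPm, hmα, hmδ, -⟩ := exists_inter_line hα hδ n2 hP (hkδ hPk)
  refine ⟨l, m, hl, hm, ?_, hlα, hmα, P, hPl, hPm⟩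
  rintro rfl
  obtain ⟨X, hX, hXP⟩ := exists_ne_mem hl P
  have hXk : X ∉ k := by
    intro h
    have := line_ext hl hk hX hPl h hPk hXP
    subst this
    exact hQ (hlα hQk)
  have := plane_ext_line hk hγ hδ hXk hkγ hkδ (hlγ hX) (hmδ hX)
  subst this
  exact hS hSδ

theorem exists_mem_plane_notMem_line {α a : Set E} (hα : IsPlane α) (ha : IsLine a) :
    ∃ X ∈ α, X ∉ a := by
  obtain ⟨l, m, hl, hm, hlm, hlα, hmα, P, hPl, hPm⟩ := exists_lines_in_plane hα
  obtain ⟨X, hX, hXP⟩ := exists_ne_mem hl P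
  obtain ⟨Y, hY, hYP⟩ := exists_ne_mem hm P
  by_contra! h
  have h1 := line_ext hl ha hX hPl (h X (hlα hX)) (h P (hlα hPl)) hXP
  have h2 := line_ext hm ha hY hPm (h Y (hmα hY)) (h P (hlα hPl)) hYP
  exact hlm (h1.trans h2.symm)

/-! ### Order -/

theorem pasch_opp {α a : Set E} (hα : IsPlane α) (ha : IsLine a) (haα : a ⊆ α) {A B C : E}
    (h1 : A ∈ α) (h2 : B ∈ α) (h3 : C ∈ α) (hn : ¬ Collinear A B C) (hA : A ∉ a) (hB : B ∉ a)
    (hC : C ∉ a) (h : Opp a A B) : Opp a A C ∨ Opp a B C :=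
  pasch α a hα ha haα A B C h1 h2 h3 hn hA hB hC h

/-- Draw a line m through C and a point X off the given line, and choose G beyond B on XB, so that m
misses BG. As m misses AB and BG, it misses AG; as it crosses BD, it crosses DG and hence DA,
necessarily at C. -/
theorem btw_of_btw_of_not_btw {A B C D : E} (h : Btw B C D) (hc : Collinear A B C) (hAC : A ≠ C)
    (hn : ¬ Btw A C B) : Btw A C D := by
  by_cases hAB : A = B
  · rwa [hAB]
  obtain ⟨g, hg, hA, hB, hC⟩ := hc
  have hD : D ∈ g := h.mem_right hg hB hC
  obtain ⟨hBC, hCD, hBD⟩ := h.ne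
  have hAD : A ≠ D := by
    rintro rfl
    exact hn h.symm
  obtain ⟨X, hX⟩ := exists_notMem_line hg
  obtain ⟨α, hα, hgα, hXα⟩ := exists_plane_line hg hX
  have hCX : C ≠ X := fun h' => hX (h' ▸ hC)
  have hXB : X ≠ B := fun h' => hX (h' ▸ hB)
  obtain ⟨m, hm, hCm, hXm⟩ := exists_line hCX
  have hmα := line_subset hm hα hCX hCm hXm (hgα hC) hXα
  obtain ⟨G, hG⟩ := btw_extend X B hXB
  obtain ⟨n, hn1, hXn, hBn⟩ := exists_line hXB
  have hGn := hG.mem_right hn1 hXn hBn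
  have hnα := line_subset hn1 hα hXB hXn hBn hXα (hgα hB)
  have hgm : g ≠ m := by rintro rfl; exact hX hXm
  have hgn : g ≠ n := by rintro rfl; exact hX hXn
  have e1 : ∀ Y, Y ∈ g → Y ∈ m → Y = C := fun Y h1 h2 => line_inter hg hm hgm h1 h2 hC hCm
  have hmn : m ≠ n := by
    rintro rfl
    exact hBC (e1 B hB hBn)
  have hAm : A ∉ m := fun h' => hAC (e1 A hA h')
  have hBm : B ∉ m := fun h' => hBC (e1 B hB h')
  have hDm : D ∉ m := fun h' => hCD (e1 D hD h').symm
  have hGm : G ∉ m := fun h' => hG.ne.2.2 (line_inter hm hn1 hmn hXm hXn h' hGn)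
  have hGg : G ∉ g := fun h' => hG.ne.2.1 (line_inter hg hn1 hgn hB hBn h' hGn)
  have o1 : ¬ Opp m A B := by
    rintro ⟨Y, hY, h'⟩
    rw [e1 Y (h'.mem_mid hg hA hB) hY] at h'
    exact hn h'
  have o2 : ¬ Opp m B G := by
    rintro ⟨Y, hY, h'⟩
    rw [line_inter hm hn1 hmn hY (h'.mem_mid hn1 hBn hGn) hXm hXn] at h'
    exact hG.not2 h'
  have nc : ∀ {P Q : E}, P ∈ g → Q ∈ g → P ≠ Q → ¬ Collinear P Q G := fun hP hQ hPQ hc =>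
    hGg ((collinear_iff_mem hg hPQ hP hQ).1 hc)
  have hGα := hnα hGn
  have o3 : ¬ Opp m A G := by
    intro h'
    rcases pasch_opp hα hm hmα (hgα hA) hGα (hgα hB)
      (fun hc => nc hB hA (Ne.symm hAB) (collinear_rotate (collinear_rotate hc))) hAm hGm hBm h'
      with h'' | h''
    · exact o1 h''
    · exact o2 h''.symm
  have o4 : Opp m D G := (pasch_opp hα hm hmα (hgα hB) (hgα hD) hGα (nc hB hD hBD) hBm hDm hGm
    ⟨C, hCm, h⟩).resolve_left o2
  have o5 : Opp m D A := (pasch_opp hα hm hmα (hgα hD) hGα (hgα hA)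
      (fun hc => nc hA hD hAD (collinear_rotate (collinear_rotate hc))) hDm hGm hAm
    o4).resolve_right (fun h' => o3 h'.symm)
  obtain ⟨Y, hY, h'⟩ := o5
  rw [e1 Y (h'.mem_mid hg hD hA) hY] at h'
  exact h'.symm

/-- Of three distinct points of a line, one lies between the other two. -/
theorem btw_trichotomy {l : Set E} (hl : IsLine l) {A B C : E} (hA : A ∈ l) (hB : B ∈ l)
    (hC : C ∈ l) (hAB : A ≠ B) (hBC : B ≠ C) (hAC : A ≠ C) :
    Btw A B C ∨ Btw B C A ∨ Btw C A B := by
  by_contra! ⟨n1, n2, n3⟩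
  obtain ⟨D, hD⟩ := exists_notMem_line hl
  obtain ⟨α, hα, hlα, hDα⟩ := exists_plane_line hl hD
  have hBD : B ≠ D := fun h => hD (h ▸ hB)
  have hAD : A ≠ D := fun h => hD (h ▸ hA)
  have hCD : C ≠ D := fun h => hD (h ▸ hC)
  -- Repeated Pasch: AD meets GC in X and CD meets GA in Y. The line CD then crosses AX at D, and
  -- finally BD must cross AC at B, which was excluded.
  obtain ⟨G, hG⟩ := btw_extend B D hBD
  obtain ⟨b, hb, hBb, hDb⟩ := exists_line hBD
  obtain ⟨a, ha, hAa, hDa⟩ := exists_line hAD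
  obtain ⟨c, hc, hCc, hDc⟩ := exists_line hCD
  have hGb := hG.mem_right hb hBb hDb
  have hbl : b ≠ l := by rintro rfl; exact hD hDb
  have hal : a ≠ l := by rintro rfl; exact hD hDa
  have hcl : c ≠ l := by rintro rfl; exact hD hDc
  have hab : a ≠ b := by rintro rfl; exact hAB (line_inter ha hl hal hAa hA hBb hB)
  have hcb : c ≠ b := by rintro rfl; exact hBC (line_inter hc hl hcl hBb hB hCc hC)
  have hac : a ≠ c := by rintro rfl; exact hAC (line_inter ha hl hal hAa hA hCc hC)
  have sa := line_subset ha hα hAD hAa hDa (hlα hA) hDα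
  have sb := line_subset hb hα hBD hBb hDb (hlα hB) hDα
  have sc := line_subset hc hα hCD hCc hDc (hlα hC) hDα
  have hGa : G ∉ a := fun h => hG.ne.2.1 (line_inter ha hb hab hDa hDb h hGb)
  have hGc : G ∉ c := fun h => hG.ne.2.1 (line_inter hc hb hcb hDc hDb h hGb)
  have hGl : G ∉ l := fun h => hG.ne.2.2 (line_inter hb hl hbl hBb hB hGb h)
  have hBa : B ∉ a := fun h => hAB (line_inter ha hl hal hAa hA h hB)
  have hCa : C ∉ a := fun h => hAC (line_inter ha hl hal hAa hA h hC)
  have hBc : B ∉ c := fun h => hBC (line_inter hc hl hcl h hB hCc hC)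
  have hAc : A ∉ c := fun h => hAC (line_inter hc hl hcl h hA hCc hC)
  have hAb : A ∉ b := fun h => hAB (line_inter hb hl hbl h hA hBb hB)
  have hCb : C ∉ b := fun h => hBC (line_inter hb hl hbl hBb hB h hC)
  have hGα := sb hGb
  have nc : ∀ {P Q : E}, P ∈ l → Q ∈ l → P ≠ Q → ¬ Collinear P G Q := fun hP hQ hPQ hc =>
    hGl ((collinear_iff_mem hl hPQ hP hQ).1 (collinear_rotate (collinear_rotate
      (collinear_swap (collinear_rotate hc)))) )
  obtain ⟨X, hXa, hX⟩ : Opp a G C := by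
    rcases pasch_opp hα ha sa (hlα hB) hGα (hlα hC) (nc hB hC hBC) hBa hGa hCa ⟨D, hDa, hG⟩
      with ⟨Y, hY, h⟩ | h
    · rw [line_inter ha hl hal hY (h.mem_mid hl hB hC) hAa hA] at h
      exact absurd h.symm n3
    · exact h
  obtain ⟨Y, hYc, hY⟩ : Opp c G A := by
    rcases pasch_opp hα hc sc (hlα hB) hGα (hlα hA) (nc hB hA hAB.symm) hBc hGc hAc ⟨D, hDc, hG⟩
      with ⟨Y, hY, h⟩ | h
    · rw [line_inter hc hl hcl hY (h.mem_mid hl hB hA) hCc hC] at h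
      exact absurd h n2
    · exact h
  have hGC : G ≠ C := fun h => hGl (h ▸ hC)
  obtain ⟨e, he, hGe, hCe⟩ := exists_line hGC
  have hXe := hX.mem_mid he hGe hCe
  have hel : e ≠ l := by rintro rfl; exact hGl hGe
  have hAe : A ∉ e := fun h => hAC (line_inter he hl hel h hA hCe hC)
  have hXA : X ≠ A := fun h => hAe (h ▸ hXe)
  have hce : c ≠ e := by rintro rfl; exact hGc hGe
  have hbe : b ≠ e := by rintro rfl; exact hCb hCe
  have hae : a ≠ e := by rintro rfl; exact hCa hCe
  have hXc : X ∉ c := fun h => hX.ne.2.1 (line_inter hc he hce h hXe hCc hCe)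
  have hXb : X ∉ b := fun h => hX.ne.1 (line_inter hb he hbe hGb hGe h hXe)
  have hXl : X ∉ l := fun h => hX.ne.2.1 (line_inter he hl hel hXe h hCe hC)
  obtain ⟨Z, hZc, hZ⟩ : Opp c A X := by
    rcases pasch_opp hα hc sc (hlα hA) hGα (sa hXa)
      (fun h => hGa ((collinear_iff_mem ha hXA hXa hAa).1 (collinear_rotate (collinear_rotate h))))
      hAc hGc hXc ⟨Y, hYc, hY.symm⟩ with h | ⟨Z, hZ, h⟩
    · exact h
    · rw [line_inter hc he hce hZ (h.mem_mid he hGe hXe) hCc hCe] at h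
      exact absurd h.symm hX.symm.not2
  rw [line_inter hc ha hac.symm hZc (hZ.mem_mid ha hAa hXa) hDc hDa] at hZ
  rcases pasch_opp hα hb sb (hlα hA) (sa hXa) (hlα hC)
      (fun h => hCa ((collinear_iff_mem ha hXA.symm hAa hXa).1 h)) hAb hXb hCb ⟨D, hDb, hZ⟩
    with ⟨W, hW, h⟩ | ⟨W, hW, h⟩
  · rw [line_inter hb hl hbl hW (h.mem_mid hl hA hC) hBb hB] at h
    exact n1 h
  · rw [line_inter hb he hbe hW (h.mem_mid he hXe hCe) hGb hGe] at h
    exact hX.not2 h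

theorem _root_.SpacePrimitives.Btw.trans_inner {A B C D : E}
    (h1 : Btw A B C) (h2 : Btw B C D) : Btw A C D :=
  btw_of_btw_of_not_btw h2 h1.col h1.ne.2.2 (fun h => h1.not1 h.symm)

theorem _root_.SpacePrimitives.Btw.trans_inner' {A B C D : E}
    (h1 : Btw A B C) (h2 : Btw B C D) : Btw A B D :=
  (h2.symm.trans_inner h1.symm).symm

theorem _root_.SpacePrimitives.Btw.trans_outer {A B C D : E}
    (h1 : Btw A B C) (h2 : Btw A C D) : Btw B C D :=
  btw_of_btw_of_not_btw h2 (collinear_swap h1.col) h1.ne.2.1 h1.not1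

/-- Two points separated from a third by `C` are not separated by `C`. -/
theorem _root_.SpacePrimitives.Btw.not_btw {A B C D : E}
    (h1 : Btw A C B) (h2 : Btw D C B) : ¬ Btw A C D := by
  intro h
  obtain ⟨l, hl, hA, hC, hB⟩ := h1.col
  have hD := h.mem_right hl hA hC
  rcases btw_trichotomy hl hA hB hD h1.ne.2.2 h2.ne.2.2.symm h.ne.2.2 with h' | h' | h'
  · exact (h1.trans_outer h').not2 h2.symm
  · exact (h2.symm.trans_outer h').not2 h.symm
  · exact (h.symm.trans_outer h').not2 h1

/-! ### Separation -/

/-- A set of points that contains every line through two of its points. -/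
def Flat (S : Set E) : Prop :=
  ∀ ⦃l : Set E⦄, IsLine l → ∀ ⦃P Q : E⦄, P ≠ Q → P ∈ l → Q ∈ l → P ∈ S → Q ∈ S → l ⊆ S

theorem flat_line {a : Set E} (ha : IsLine a) : Flat a := by
  intro l hl P Q h h1 h2 h3 h4
  rw [line_ext hl ha h1 h2 h3 h4 h]

theorem flat_plane {α : Set E} (hα : IsPlane α) : Flat α :=
  fun _ hl _ _ h h1 h2 h3 h4 => line_subset hl hα h h1 h2 h3 h4

theorem Flat.unique {S : Set E} (hS : Flat S) {l : Set E} (hl : IsLine l) {A P Q : E}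
    (hA : A ∈ l) (hAS : A ∉ S) (hP : P ∈ l) (hPS : P ∈ S) (hQ : Q ∈ l) (hQS : Q ∈ S) : P = Q := by
  by_contra h
  exact hAS (hS hl h hP hQ hPS hQS hA)

theorem Flat.mem_right {S : Set E} (hS : Flat S) {A B C : E} (h : Btw A B C) (hA : A ∈ S)
    (hB : B ∈ S) : C ∈ S := by
  obtain ⟨l, hl, h1, h2, h3⟩ := h.col
  exact hS hl h.ne.1 h1 h2 hA hB h3

theorem Flat.mem_left {S : Set E} (hS : Flat S) {A B C : E} (h : Btw A B C) (hB : B ∈ S)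
    (hC : C ∈ S) : A ∈ S :=
  hS.mem_right h.symm hC hB

theorem Flat.mem_mid {S : Set E} (hS : Flat S) {A B C : E} (h : Btw A B C) (hA : A ∈ S)
    (hC : C ∈ S) : B ∈ S := by
  obtain ⟨l, hl, h1, h2, h3⟩ := h.col
  exact hS hl h.ne.2.2 h1 h3 hA hC h2

theorem mem_ray_self (O A : E) : A ∈ ray O A := Or.inr (Or.inl rfl)

theorem mem_ray_symm {O A X : E} (h : X ∈ ray O A) (hX : X ≠ O) : A ∈ ray O X := by
  rcases h with h | h | h | h
  · exact absurd h hX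
  · exact Or.inr (Or.inl h.symm)
  · exact Or.inr (Or.inr (Or.inr h))
  · exact Or.inr (Or.inr (Or.inl h))

theorem mem_ray_or_btw {l : Set E} (hl : IsLine l) {O A X : E} (hO : O ∈ l) (hA : A ∈ l)
    (hX : X ∈ l) (h : O ≠ A) : X ∈ ray O A ∨ Btw A O X := by
  by_cases h1 : X = O
  · exact Or.inl (Or.inl h1)
  by_cases h2 : X = A
  · exact Or.inl (Or.inr (Or.inl h2))
  rcases btw_trichotomy hl hA hO hX h.symm (Ne.symm h1) (Ne.symm h2) with h' | h' | h'
  · exact Or.inr h'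
  · exact Or.inl (Or.inr (Or.inr (Or.inl h')))
  · exact Or.inl (Or.inr (Or.inr (Or.inr h'.symm)))

theorem Flat.mem_of_ray {S : Set E} (hS : Flat S) {O A X : E} (h : X ∈ ray O A) (hO : O ∈ S)
    (hA : A ∈ S) : X ∈ S := by
  rcases h with h | h | h | h
  · rwa [h]
  · rwa [h]
  · exact hS.mem_mid h hO hA
  · exact hS.mem_right h hO hA

theorem Flat.notMem_of_ray {S : Set E} (hS : Flat S) {O A X : E} (h : X ∈ ray O A) (hXO : X ≠ O)
    (hO : O ∈ S) (hA : A ∉ S) : X ∉ S :=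
  fun hX => hA (hS.mem_of_ray (mem_ray_symm h hXO) hO hX)

theorem ray_not_btw {O A X : E} (h : X ∈ ray O A) : ¬ Btw A O X := by
  rcases h with rfl | rfl | h | h
  · exact fun h => h.ne.2.1 rfl
  · exact fun h => h.ne.2.2 rfl
  · exact fun h' => h'.not1 h
  · exact h.not2

/-- The line of the ray meets S only in O, and O does not lie between two points of its ray. -/
theorem Flat.not_opp_of_ray {S : Set E} (hS : Flat S) {O A X : E} (h : X ∈ ray O A)
    (hO : O ∈ S) (hA : A ∉ S) : ¬ Opp S A X := by
  rintro ⟨Y, hY, h'⟩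
  obtain ⟨l, hl, h1, h2, h3⟩ := h'.col
  by_cases hXO : X = O
  · exact h'.ne.2.1 (hS.unique hl h1 hA h2 hY h3 (hXO ▸ hO))
  have hOl : O ∈ l := by
    rcases h with h | h | h | h
    · exact absurd h hXO
    · exact absurd h.symm h'.ne.2.2
    · exact h.mem_left hl h3 h1
    · exact h.mem_left hl h1 h3
  rw [hS.unique hl h1 hA h2 hY hOl hO] at h'
  exact ray_not_btw h h'

/-- The set `S` separates `U`: it divides `U \ S` into at most two classes. -/
structure Separates (S U : Set E) : Prop where
  pasch : ∀ {A B C : E}, A ∈ U → B ∈ U → C ∈ U → A ∉ S → B ∉ S → C ∉ S → Opp S A B →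
    Opp S A C ∨ Opp S B C
  two : ∀ {A B C : E}, A ∈ U → B ∈ U → C ∈ U → A ∉ S → B ∉ S → C ∉ S → Opp S A B →
    Opp S B C → ¬ Opp S A C

theorem Flat.opp_or_of_collinear {S : Set E} {A B C : E} (hc : Collinear A B C)
    (hC : C ∉ S) (h : Opp S A B) : Opp S A C ∨ Opp S B C := by
  obtain ⟨X, hX, h⟩ := h
  by_cases h' : Btw A X C
  · exact Or.inl ⟨X, hX, h'⟩
  obtain ⟨l, hl, h1, h2, h3⟩ := hc
  have h4 := h.mem_mid hl h1 h2
  exact Or.inr ⟨X, hX, (btw_of_btw_of_not_btw h ⟨l, hl, h3, h1, h4⟩ (fun e => hC (e ▸ hX))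
    (fun e => h' e.symm)).symm⟩

/-- All three crossing points coincide with the only point of the line in S, and a single point
cannot separate three points pairwise. -/
theorem Flat.not_all_opp_of_collinear {S : Set E} (hS : Flat S) {A B C : E} (hc : Collinear A B C)
    (hA : A ∉ S) (h1 : Opp S A B) (h2 : Opp S B C) : ¬ Opp S A C := by
  rintro ⟨Z, hZ, h3⟩
  obtain ⟨X, hX, h1⟩ := h1
  obtain ⟨Y, hY, h2⟩ := h2
  obtain ⟨l, hl, hAl, hBl, hCl⟩ := hc
  have hXl := h1.mem_mid hl hAl hBl
  have hYl := h2.mem_mid hl hBl hCl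
  have hZl := h3.mem_mid hl hAl hCl
  rw [hS.unique hl hAl hA hYl hY hXl hX] at h2
  rw [hS.unique hl hAl hA hZl hZ hXl hX] at h3
  exact h1.not_btw h2.symm h3

/-- Pasch for the triangle XZA and the line BC: entering at Y, the line would have to leave between
A and X or between A and Z, but it meets the lines AX and AZ only in B and C, which lie beyond X and
Z. -/
theorem not_btw_of_opp_of_opp {α a : Set E} (hα : IsPlane α) (ha : IsLine a)
    {A B C X Y Z : E} (hBα : B ∈ α) (hCα : C ∈ α)
    (hXα : X ∈ α) (hZα : Z ∈ α) (hAa : A ∉ a)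
    (hXa : X ∈ a) (hZa : Z ∈ a) (hn : ¬ Collinear A B C)
    (h1 : Btw A X B) (h2 : Btw B Y C) (h3 : Btw A Z C) : ¬ Btw X Y Z := by
  intro h
  have hAα := (flat_plane hα).mem_left h1 hXα hBα
  obtain ⟨hAB, hBC, hAC⟩ := ne_of_not_collinear hn
  obtain ⟨l, hl, hBl, hCl⟩ := exists_line hBC
  have hAl : A ∉ l := fun h => hn ⟨l, hl, h, hBl, hCl⟩
  have hYl := h2.mem_mid hl hBl hCl
  have hXl : X ∉ l := fun h' => hAl (h1.mem_left hl h' hBl)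
  have hZl : Z ∉ l := fun h' => hAl (h3.mem_left hl h' hCl)
  have hn' : ¬ Collinear X Z A := fun hc => hAa ((collinear_iff_mem ha h.ne.2.2 hXa hZa).1 hc)
  rcases pasch_opp hα hl (line_subset hl hα hBC hBl hCl hBα hCα) hXα hZα hAα hn' hXl hZl hAl
    ⟨Y, hYl, h⟩ with ⟨W, hW, h'⟩ | ⟨W, hW, h'⟩
  · obtain ⟨m, hm, m1, m2, m3⟩ := h1.col
    have := (flat_line hl).unique hm m1 hAl (h'.mem_mid hm m2 m1) hW m3 hBl
    rw [this] at h'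
    exact h1.not1 h'
  · obtain ⟨m, hm, m1, m2, m3⟩ := h3.col
    have := (flat_line hl).unique hm m1 hAl (h'.mem_mid hm m2 m1) hW m3 hCl
    rw [this] at h'
    exact h3.not1 h'

theorem separates_line {α a : Set E} (hα : IsPlane α) (ha : IsLine a) (haα : a ⊆ α) :
    Separates a α where
  pasch := by
    intro A B C h1 h2 h3 hA hB hC h
    by_cases hc : Collinear A B C
    · exact Flat.opp_or_of_collinear hc hC h
    · exact pasch_opp hα ha haα h1 h2 h3 hc hA hB hC h
  two := by
    intro A B C h1 h2 h3 hA hB hC o1 o2 o3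
    by_cases hc : Collinear A B C
    · exact (flat_line ha).not_all_opp_of_collinear hc hA o1 o2 o3
    obtain ⟨hAB, hBC, hAC⟩ := ne_of_not_collinear hc
    obtain ⟨X, hX, o1⟩ := o1
    obtain ⟨Y, hY, o2⟩ := o2
    obtain ⟨Z, hZ, o3⟩ := o3
    have hc' : ¬ Collinear B C A := fun h => hc (collinear_rotate (collinear_rotate h))
    have hc2 : ¬ Collinear C A B := fun h => hc (collinear_rotate h)
    have aux : ∀ {A B C X Z : E}, ¬ Collinear A B C → A ∉ a → X ∈ a → Btw A X B → Btw A Z C →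
        X ≠ Z := by
      rintro A B C X _ hc hA hX o1 o3 rfl
      obtain ⟨l, hl, l1, l2, l3⟩ := o1.col
      exact hc ⟨l, hl, l1, l3, o3.mem_right hl l1 l2⟩
    have hXZ : X ≠ Z := aux hc hA hX o1 o3
    have hXY : X ≠ Y := (aux hc' hB hY o2 o1.symm).symm
    have hYZ : Y ≠ Z := (aux hc2 hC hZ o3.symm o2.symm).symm
    rcases btw_trichotomy ha hX hY hZ hXY hYZ hXZ with h | h | h
    · exact not_btw_of_opp_of_opp hα ha h2 h3 (haα hX) (haα hZ) hA hX hZ hc o1 o2 o3 h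
    · exact not_btw_of_opp_of_opp hα ha h3 h1 (haα hY) (haα hX) hB hY hX hc' o2 o3.symm o1.symm h
    · exact not_btw_of_opp_of_opp hα ha h1 h2 (haα hZ) (haα hY) hC hZ hY hc2 o3.symm o1 o2.symm h

/-- In the plane of three non-collinear points, α cuts out a line with the same separation, so the
planar statement applies. -/
theorem separates_plane {α : Set E} (hα : IsPlane α) : Separates α Set.univ := by
  have aux : ∀ {A B C : E}, A ∉ α → ¬ Collinear A B C → Opp α A B →
      ∃ γ l : Set E, IsPlane γ ∧ IsLine l ∧ l ⊆ γ ∧ A ∈ γ ∧ B ∈ γ ∧ C ∈ γ ∧ l ⊆ α ∧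
        ∀ {P Q : E}, P ∈ γ → Q ∈ γ → Opp α P Q → Opp l P Q := by
    rintro A B C hA hc ⟨X, hX, h⟩
    obtain ⟨γ, hγ, h1, h2, h3⟩ := exists_plane hc
    have hne : α ≠ γ := by rintro rfl; exact hA h1
    obtain ⟨l, hl, hXl, hlα, hlγ, hlu⟩ :=
      exists_inter_line hα hγ hne hX ((flat_plane hγ).mem_mid h h1 h2)
    refine ⟨γ, l, hγ, hl, hlγ, h1, h2, h3, hlα, ?_⟩
    rintro P Q hP hQ ⟨Y, hY, h'⟩
    exact ⟨Y, hlu Y hY ((flat_plane hγ).mem_mid h' hP hQ), h'⟩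
  constructor
  · intro A B C _ _ _ hA hB hC h
    by_cases hc : Collinear A B C
    · exact Flat.opp_or_of_collinear hc hC h
    obtain ⟨γ, l, hγ, hl, hlγ, h1, h2, h3, hlα, ho⟩ := aux hA hc h
    rcases (separates_line hγ hl hlγ).pasch h1 h2 h3 (fun h => hA (hlα h)) (fun h => hB (hlα h))
      (fun h => hC (hlα h)) (ho h1 h2 h) with ⟨Y, hY, h⟩ | ⟨Y, hY, h⟩
    · exact Or.inl ⟨Y, hlα hY, h⟩
    · exact Or.inr ⟨Y, hlα hY, h⟩
  · intro A B C _ _ _ hA hB hC o1 o2 o3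
    by_cases hc : Collinear A B C
    · exact (flat_plane hα).not_all_opp_of_collinear hc hA o1 o2 o3
    obtain ⟨γ, l, hγ, hl, hlγ, h1, h2, h3, hlα, ho⟩ := aux hA hc o1
    exact (separates_line hγ hl hlγ).two h1 h2 h3 (fun h => hA (hlα h)) (fun h => hB (hlα h))
      (fun h => hC (hlα h)) (ho h1 h2 o1) (ho h2 h3 o2) (ho h1 h3 o3)

theorem Separates.same {S U : Set E} (h : Separates S U) {A B C : E}
    (hA : A ∈ U) (hB : B ∈ U) (hC : C ∈ U) (hA' : A ∉ S)
    (hB' : B ∉ S) (hC' : C ∉ S)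
    (hAB : ¬ Opp S A B) : Opp S A C ↔ Opp S B C := by
  have h1 := h.pasch hA hC hB hA' hC' hB'
  have h2 := h.pasch hB hC hA hB' hC' hA'
  rw [opp_comm (A := C)] at h1 h2
  rw [opp_comm (A := B) (B := A)] at h2
  tauto

theorem Separates.opp {S U : Set E} (h : Separates S U) {A B C : E}
    (hA : A ∈ U) (hB : B ∈ U) (hC : C ∈ U) (hA' : A ∉ S)
    (hB' : B ∉ S) (hC' : C ∉ S)
    (hAB : Opp S A B) : Opp S A C ↔ ¬ Opp S B C := by
  have h1 := h.pasch hA hB hC hA' hB' hC' hAB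
  have h2 := h.two hA hB hC hA' hB' hC' hAB
  tauto

theorem not_opp_self {S : Set E} (A : E) : ¬ Opp S A A := fun ⟨_, _, h⟩ => h.ne.2.2 rfl

/-- The points of `U \ S` that are not separated from `A` by `S`. -/
def sideOf (U S : Set E) (A : E) : Set E := {X | X ∈ U ∧ X ∉ S ∧ ¬ Opp S A X}

theorem disjoint_seg_iff {S : Set E} {A X : E} (hA : A ∉ S) (hX : X ∉ S) :
    Disjoint (seg A X) S ↔ ¬ Opp S A X := by
  rw [Set.disjoint_left]
  constructor
  · rintro h ⟨Y, hY, h'⟩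
    exact h (Or.inr (Or.inr h')) hY
  · rintro h Y (rfl | rfl | h') hY
    · exact hA hY
    · exact hX hY
    · exact h ⟨Y, hY, h'⟩

theorem halfPlaneOf_eq {α a : Set E} {A : E} (hA : A ∉ a) : halfPlaneOf α a A = sideOf α a A := by
  ext X
  constructor
  · rintro ⟨h1, h2, h3⟩
    exact ⟨h1, h2, (disjoint_seg_iff hA h2).1 h3⟩
  · rintro ⟨h1, h2, h3⟩
    exact ⟨h1, h2, (disjoint_seg_iff hA h2).2 h3⟩

theorem halfSpaceOf_eq {α : Set E} {A : E} (hA : A ∉ α) :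
    halfSpaceOf α A = sideOf Set.univ α A := by
  ext X
  constructor
  · rintro ⟨h2, h3⟩
    exact ⟨trivial, h2, (disjoint_seg_iff hA h2).1 h3⟩
  · rintro ⟨-, h2, h3⟩
    exact ⟨h2, (disjoint_seg_iff hA h2).2 h3⟩

theorem Separates.sideOf_eq {S U : Set E} (h : Separates S U) {A B : E} (hA : A ∈ U) (hB : B ∈ U)
    (hA' : A ∉ S) (hB' : B ∉ S) (hAB : ¬ Opp S A B) : sideOf U S A = sideOf U S B := by
  ext X
  constructor
  · rintro ⟨h1, h2, h3⟩
    exact ⟨h1, h2, (h.same hA hB h1 hA' hB' h2 hAB).not.1 h3⟩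
  · rintro ⟨h1, h2, h3⟩
    exact ⟨h1, h2, (h.same hA hB h1 hA' hB' h2 hAB).not.2 h3⟩

/-- Two different sides: the other side consists of the points separated from `A`. -/
theorem Separates.mem_other {S U : Set E} (h : Separates S U) {A B : E} (hA : A ∈ U) (hB : B ∈ U)
    (hA' : A ∉ S) (hB' : B ∉ S) (hne : sideOf U S A ≠ sideOf U S B) :
    sideOf U S B = {X | X ∈ U ∧ X ∉ S ∧ Opp S A X} := by
  have hAB : Opp S A B := by
    by_contra hn
    exact hne (h.sideOf_eq hA hB hA' hB' hn)
  ext X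
  constructor
  · rintro ⟨h1, h2, h3⟩
    exact ⟨h1, h2, (h.opp hA hB h1 hA' hB' h2 hAB).2 h3⟩
  · rintro ⟨h1, h2, h3⟩
    exact ⟨h1, h2, (h.opp hA hB h1 hA' hB' h2 hAB).1 h3⟩

/-! ### Congruence of segments -/

theorem seg_comm (A B : E) : seg A B = seg B A := by
  ext X
  constructor <;> rintro (h | h | h)
  · exact Or.inr (Or.inl h)
  · exact Or.inl h
  · exact Or.inr (Or.inr h.symm)
  · exact Or.inr (Or.inl h)
  · exact Or.inl h
  · exact Or.inr (Or.inr h.symm)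

/-- Lay CD off on the ray AB. By transitivity the end point also lays off AB there, so uniqueness
identifies it with B. -/
theorem segCong_symm {A B C D : E} (h : A ≠ B) (h' : C ≠ D)
    (hc : SegCong (seg A B) (seg C D)) : SegCong (seg C D) (seg A B) := by
  obtain ⟨X, ⟨h1, h2, h3⟩, hu⟩ := segCong_layoff C D A B h' h
  have h4 := segCong_trans A B C D A X h h' (Ne.symm h2) hc h3
  obtain ⟨Y, -, hu'⟩ := segCong_layoff A B A B h h
  have e1 := hu' X ⟨h1, h2, h4⟩
  have e2 := hu' B ⟨mem_ray_self A B, h.symm, segCong_refl A B h⟩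
  rwa [e1, ← e2] at h3

/-- The distance from `A` to `B`: the class of all pairs of ending points of segments congruent to
`[AB]`. -/
def d (A B : E) : Set (E × E) :=
  {p | (A = B ∧ p.1 = p.2) ∨ (A ≠ B ∧ p.1 ≠ p.2 ∧ SegCong (seg A B) (seg p.1 p.2))}

/-- Congruence becomes an equality that can be rewritten with. Degenerate pairs form one class of
their own, which spares distinctness hypotheses later. -/
theorem d_eq_iff {A B C D : E} :
    d A B = d C D ↔ (A = B ∧ C = D) ∨ (A ≠ B ∧ C ≠ D ∧ SegCong (seg A B) (seg C D)) := by
  constructor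
  · intro h
    have : (C, D) ∈ d C D := by
      by_cases h' : C = D
      · exact Or.inl ⟨h', h'⟩
      · exact Or.inr ⟨h', h', segCong_refl C D h'⟩
    rw [← h] at this
    exact this
  · rintro (⟨h1, h2⟩ | ⟨h1, h2, h3⟩)
    · ext p
      simp [d, h1, h2]
    · ext ⟨P, Q⟩
      simp only [d, Set.mem_ofPred_eq, h1, h2, false_and, false_or, ne_eq, not_false_eq_true,
        true_and]
      constructor
      · rintro ⟨h4, h5⟩
        exact ⟨h4, segCong_trans C D A B P Q h2 h1 h4 (segCong_symm h1 h2 h3) h5⟩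
      · rintro ⟨h4, h5⟩
        exact ⟨h4, segCong_trans A B C D P Q h1 h2 h4 h3 h5⟩

theorem d_comm (A B : E) : d A B = d B A := by
  rw [d_eq_iff]
  by_cases h : A = B
  · exact Or.inl ⟨h, h.symm⟩
  · refine Or.inr ⟨h, Ne.symm h, ?_⟩
    rw [seg_comm B A]
    exact segCong_refl A B h

theorem d_self (A B : E) : d A A = d B B := d_eq_iff.2 (Or.inl ⟨rfl, rfl⟩)

theorem eq_iff_of_d {A B C D : E} (h : d A B = d C D) : A = B ↔ C = D := by
  rw [d_eq_iff] at h
  tauto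

theorem ne_of_d {A B C D : E} (h : d A B = d C D) (h' : A ≠ B) : C ≠ D :=
  fun e => h' ((eq_iff_of_d h).2 e)

theorem segCong_of_d {A B C D : E} (h : d A B = d C D) (h' : A ≠ B) :
    SegCong (seg A B) (seg C D) := by
  rw [d_eq_iff] at h
  tauto

theorem d_of_segCong {A B C D : E} (h : A ≠ B) (h' : C ≠ D) (hc : SegCong (seg A B) (seg C D)) :
    d A B = d C D :=
  d_eq_iff.2 (Or.inr ⟨h, h', hc⟩)

theorem exists_d_ray {C P : E} (h : C ≠ P) (A B : E) : ∃ D ∈ ray C P, d C D = d A B := by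
  by_cases hAB : A = B
  · exact ⟨C, Or.inl rfl, d_eq_iff.2 (Or.inl ⟨rfl, hAB⟩)⟩
  · obtain ⟨D, ⟨h1, h2, h3⟩, -⟩ := segCong_layoff A B C P hAB h
    exact ⟨D, h1, (d_of_segCong hAB h2.symm h3).symm⟩

theorem eq_of_d_ray {C P D D' : E} (h : C ≠ P) (h1 : D ∈ ray C P) (h2 : D' ∈ ray C P)
    (h3 : d C D = d C D') : D = D' := by
  by_cases hD : C = D
  · exact hD.symm.trans ((eq_iff_of_d h3).1 hD)
  · have hD' := ne_of_d h3 hD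
    exact (segCong_layoff C D C P hD h).unique ⟨h1, Ne.symm hD, segCong_refl C D hD⟩
      ⟨h2, hD'.symm, segCong_of_d h3 hD⟩

theorem exists_btw_d {A B C D : E} (h : A ≠ B) (h' : C ≠ D) : ∃ X, Btw A B X ∧ d B X = d C D := by
  obtain ⟨P, hP⟩ := btw_extend A B h
  obtain ⟨X, hX, hd⟩ := exists_d_ray hP.ne.2.1 C D
  refine ⟨X, ?_, hd⟩
  rcases hX with h1 | h1 | h1 | h1
  · exact absurd h1.symm (ne_of_d hd.symm h')
  · rwa [h1]
  · exact (h1.symm.trans_outer hP.symm).symm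
  · exact hP.trans_inner' h1

theorem d_add {A B C K L M : E} (h : Btw A B C) (h' : Btw K L M) (h1 : d A B = d K L)
    (h2 : d B C = d L M) : d A C = d K M :=
  d_of_segCong h.ne.2.2 h'.ne.2.2 (segCong_add A B C K L M h h' (segCong_of_d h1 h.ne.1)
    (segCong_of_d h2 h.ne.2.1))

theorem d_sub {A B C K L M : E} (h : Btw A B C) (h' : Btw K L M) (h1 : d A B = d K L)
    (h2 : d A C = d K M) : d B C = d L M :=
  d_of_segCong h.ne.2.1 h'.ne.2.1 (segCong_sub A B C K L M h h' (segCong_of_d h1 h.ne.1)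
    (segCong_of_d h2 h.ne.2.2))

/-- Lay off AB on the ray KM and then BC beyond it. By additivity the final point is at distance AC
from K on that ray, so it is M. -/
theorem exists_btw_copy {A B C K M : E} (h : Btw A B C) (hd : d A C = d K M) :
    ∃ L, Btw K L M ∧ d A B = d K L ∧ d B C = d L M := by
  have hKM := ne_of_d hd h.ne.2.2
  obtain ⟨L, hL, h1⟩ := exists_d_ray hKM A B
  have hKL := ne_of_d h1.symm h.ne.1
  obtain ⟨N, hN, h2⟩ := exists_btw_d hKL h.ne.2.1
  have h3 := d_add h hN h1.symm h2.symm
  have e : N = M := eq_of_d_ray hKL (Or.inr (Or.inr (Or.inr hN))) (mem_ray_symm hL hKL.symm)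
    (h3.symm.trans hd)
  rw [e] at hN h2
  exact ⟨L, hN, h1.symm, h2.symm⟩

theorem btw_of_d_of_ray {A B C K L M : E} (h : Btw A B C) (hL : L ∈ ray K M) (h1 : d A B = d K L)
    (h2 : d A C = d K M) : Btw K L M := by
  obtain ⟨N, hN, h3, -⟩ := exists_btw_copy h h2
  rwa [eq_of_d_ray hN.ne.2.2 hL (Or.inr (Or.inr (Or.inl hN))) (h1.symm.trans h3)]

/-- If L were not on the ray KM, K would lie between M and L, and transporting this order back would
put A between C and B. -/
theorem btw_of_d_of_collinear {A B C K L M : E} (h : Btw A B C) (hc : Collinear K L M)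
    (h1 : d A B = d K L) (h2 : d B C = d L M) (h3 : d A C = d K M) : Btw K L M := by
  obtain ⟨l, hl, hK, hL, hM⟩ := hc
  rcases mem_ray_or_btw hl hK hM hL (ne_of_d h3 h.ne.2.2) with h' | h'
  · exact btw_of_d_of_ray h h' h1 h3
  · have h4 : Btw C A B := btw_of_d_of_ray h' (Or.inr (Or.inr (Or.inr h.symm)) : A ∈ ray C B)
      ((d_comm _ _).trans (h3.symm.trans (d_comm _ _)) : d M K = d C A)
      ((d_comm _ _).trans (h2.symm.trans (d_comm _ _)) : d M L = d C B)
    exact absurd h4.symm h.not2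

/-! ### Congruence of angles -/

theorem angle_comm (A O B : E) : angle A O B = angle B O A := by
  ext X
  constructor <;> rintro ⟨α, hα, h1, h2, h3, h4, h5⟩ <;> exact ⟨α, hα, h3, h2, h1, h5, h4⟩

theorem not_collinear_of_ray {A O B A' : E} (hn : ¬ Collinear A O B) (hA' : A' ∈ ray O A)
    (hne : A' ≠ O) : ¬ Collinear A' O B := by
  rintro ⟨l, hl, h1, h2, h3⟩
  exact hn ⟨l, hl, (flat_line hl).mem_of_ray (mem_ray_symm hA' hne) h2 h1, h2, h3⟩

/-- Moving A along its ray changes neither the line OA nor the side of OB on which A lies, so the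
angle is the same set of points. -/
theorem angle_ray {A O B A' : E} (hn : ¬ Collinear A O B) (hA' : A' ∈ ray O A) (hne : A' ≠ O) :
    angle A' O B = angle A O B := by
  obtain ⟨hAO, hOB, hAB⟩ := ne_of_not_collinear hn
  have hl := isLine_lineThrough hAO.symm
  have hO := left_mem_lineThrough O A
  have hA := right_mem_lineThrough O A
  have e1 : lineThrough O A' = lineThrough O A :=
    (eq_lineThrough hl hne.symm hO ((flat_line hl).mem_of_ray hA' hO hA)).symm
  have hm := isLine_lineThrough hOB
  have hAm : A ∉ lineThrough O B := fun h =>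
    hn ⟨_, hm, h, left_mem_lineThrough O B, right_mem_lineThrough O B⟩
  have hA'm := (flat_line hm).notMem_of_ray hA' hne (left_mem_lineThrough O B) hAm
  have ho := (flat_line hm).not_opp_of_ray hA' (left_mem_lineThrough O B) hAm
  have e2 : ∀ α : Set E, IsPlane α → A ∈ α → O ∈ α → B ∈ α →
      halfPlaneOf α (lineThrough O B) A' = halfPlaneOf α (lineThrough O B) A := by
    intro α hα h1 h2 h3
    rw [halfPlaneOf_eq hAm, halfPlaneOf_eq hA'm]
    exact ((separates_line hα hm (line_subset hm hα hOB (left_mem_lineThrough O B)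
      (right_mem_lineThrough O B) h2 h3)).sideOf_eq h1 ((flat_plane hα).mem_of_ray hA' h2 h1)
      hAm hA'm ho).symm
  ext X
  constructor
  · rintro ⟨α, hα, h1, h2, h3, h4, h5⟩
    have h1' := (flat_plane hα).mem_of_ray (mem_ray_symm hA' hne) h2 h1
    rw [e1] at h4
    rw [e2 α hα h1' h2 h3] at h5
    exact ⟨α, hα, h1', h2, h3, h4, h5⟩
  · rintro ⟨α, hα, h1, h2, h3, h4, h5⟩
    rw [← e1] at h4
    rw [← e2 α hα h1 h2 h3] at h5
    exact ⟨α, hα, (flat_plane hα).mem_of_ray hA' h2 h1, h2, h3, h4, h5⟩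

theorem exists_angle_layoff {A O B : E} (hn : ¬ Collinear A O B) {α a : Set E} (hα : IsPlane α)
    (ha : IsLine a) (haα : a ⊆ α) {Q M Y : E} (hQ : Q ∈ a) (hM : M ∈ a) (hQM : Q ≠ M)
    (hY : Y ∈ α) (hYa : Y ∉ a) :
    ∃ N ∈ α, N ∉ a ∧ ¬ Opp a Y N ∧ AngCong (angle A O B) (angle M Q N) := by
  obtain ⟨n, ⟨N, hN, -, h⟩, -⟩ := angCong_layoff A O B hn α a _ hα ha haα ⟨Y, hY, hYa, rfl⟩ Q M
    hQ hM hQM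
  rw [halfPlaneOf_eq hYa] at hN
  exact ⟨N, hN.1, hN.2.1, hN.2.2, h⟩

/-- Both congruences start from the same angle. Symmetry and transitivity of `AngCong` are not among
the axioms, so rays are compared through a common source angle. -/
theorem angle_layoff_unique {A O B : E} (hn : ¬ Collinear A O B) {α a : Set E} (hα : IsPlane α)
    (ha : IsLine a) (haα : a ⊆ α) {Q M N N' : E} (hQ : Q ∈ a) (hM : M ∈ a) (hQM : Q ≠ M)
    (hN : N ∈ α) (hNa : N ∉ a) (hN' : N' ∈ α) (hNa' : N' ∉ a) (ho : ¬ Opp a N N')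
    (h : AngCong (angle A O B) (angle M Q N)) (h' : AngCong (angle A O B) (angle M Q N')) :
    N' ∈ ray Q N := by
  have := (angCong_layoff A O B hn α a _ hα ha haα ⟨N, hN, hNa, rfl⟩ Q M hQ hM hQM).unique
    ⟨N, (halfPlaneOf_eq hNa).symm ▸ ⟨hN, hNa, not_opp_self N⟩, rfl, h⟩
    ⟨N', (halfPlaneOf_eq hNa).symm ▸ ⟨hN', hNa', ho⟩, rfl, h'⟩
  rw [this]
  exact mem_ray_self Q N'

theorem sas_angle {O A B O' A' B' : E} (hn : ¬ Collinear A O B) (hn' : ¬ Collinear A' O' B')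
    (h1 : d O A = d O' A') (h2 : d O B = d O' B') (h : AngCong (angle A O B) (angle A' O' B')) :
    AngCong (angle O A B) (angle O' A' B') := by
  obtain ⟨hAO, hOB, hAB⟩ := ne_of_not_collinear hn
  exact (angCong_sas O A B O' A' B' (fun h => hn (collinear_swap h))
    (fun h => hn' (collinear_swap h)) (segCong_of_d h1 hAO.symm) (segCong_of_d h2 hOB) h).1

/-- The axiom gives only the angles. Lay AB off on the ray A'B' to get C; the axiom applied at A and
A' makes the angle at O' leading to C a copy of the angle at O. So C lies on the ray O'B' as well as
on A'B', and C = B'. -/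
theorem sas {O A B O' A' B' : E} (hn : ¬ Collinear A O B) (hn' : ¬ Collinear A' O' B')
    (h1 : d O A = d O' A') (h2 : d O B = d O' B') (h : AngCong (angle A O B) (angle A' O' B')) :
    d A B = d A' B' := by
  obtain ⟨hAO', hOB', hAB'⟩ := ne_of_not_collinear hn'
  obtain ⟨C, hC, hd⟩ := exists_d_ray hAB' A B
  have hAC := ne_of_d hd.symm (ne_of_not_collinear hn).2.2
  have hang := sas_angle hn hn' h1 h2 h
  have hnB : ¬ Collinear B A O := fun h => hn (collinear_rotate h)
  have hnB' : ¬ Collinear B' A' O' := fun h => hn' (collinear_rotate h)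
  have hnC : ¬ Collinear C A' O' := not_collinear_of_ray hnB' hC hAC.symm
  have hang2 : AngCong (angle B A O) (angle C A' O') := by
    rw [angle_comm B, angle_ray hnB' hC hAC.symm, angle_comm B']
    exact hang
  have h3 := sas_angle (fun h => hnB (collinear_swap (collinear_rotate h)))
    (fun h => hnC (collinear_swap (collinear_rotate h)))
    ((d_comm _ _).trans (h1.trans (d_comm _ _)) : d A O = d A' O') hd.symm
    (by rw [angle_comm O, angle_comm O']; exact hang2)
  have hl := isLine_lineThrough hAO'
  have hA'l := left_mem_lineThrough A' O'
  have hO'l := right_mem_lineThrough A' O'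
  have hB'l : B' ∉ lineThrough A' O' := fun h => hn' ⟨_, hl, hA'l, hO'l, h⟩
  obtain ⟨α, hα, hlα, hB'α⟩ := exists_plane_line hl hB'l
  have hmem : C ∈ ray O' B' := angle_layoff_unique hn hα hl hlα hO'l hA'l hAO'.symm hB'α hB'l
    ((flat_plane hα).mem_of_ray hC (hlα hA'l) hB'α)
    ((flat_line hl).notMem_of_ray hC hAC.symm hA'l hB'l)
    ((flat_line hl).not_opp_of_ray hC hA'l hB'l) h h3
  suffices C = B' by rw [← hd, this]
  have hm := isLine_lineThrough hOB'
  have hk := isLine_lineThrough hAB'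
  refine (flat_line hm).unique hk (left_mem_lineThrough A' B') (fun h => hn' ⟨_, hm, h,
    left_mem_lineThrough _ _, right_mem_lineThrough _ _⟩) ?_ ?_ (right_mem_lineThrough A' B')
    (right_mem_lineThrough _ _)
  · exact (flat_line hk).mem_of_ray hC (left_mem_lineThrough _ _) (right_mem_lineThrough _ _)
  · exact (flat_line hm).mem_of_ray hmem (left_mem_lineThrough _ _) (right_mem_lineThrough _ _)

theorem not_collinear_of_btw {A O B C : E} (hn : ¬ Collinear A O B) (h : Btw A O C) :
    ¬ Collinear C O B := by
  rintro ⟨l, hl, h1, h2, h3⟩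
  exact hn ⟨l, hl, h.mem_left hl h2 h1, h2, h3⟩

theorem btw_of_ray {A O C A' C' : E} (h : Btw A O C) (hA : A' ∈ ray O A) (hA' : A' ≠ O)
    (hC : C' ∈ ray O C) (hC' : C' ≠ O) : Btw A' O C' := by
  have h1 : Btw A' O C := by
    rcases hA with h' | h' | h' | h'
    · exact absurd h' hA'
    · rwa [h']
    · exact h'.symm.trans_outer h
    · exact h'.symm.trans_inner h
  rcases hC with h' | h' | h' | h'
  · exact absurd h' hC'
  · rwa [h']
  · exact (h'.symm.trans_outer h1.symm).symm
  · exact h1.trans_inner' h'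

/-- Supplements of congruent angles are congruent. -/
theorem supplement {A O B C A' O' B' C' : E} (hn : ¬ Collinear A O B) (hn' : ¬ Collinear A' O' B')
    (h : AngCong (angle A O B) (angle A' O' B')) (hC : Btw A O C) (hC' : Btw A' O' C') :
    AngCong (angle C O B) (angle C' O' B') := by
  obtain ⟨hAO, hOB, -⟩ := ne_of_not_collinear hn
  obtain ⟨hAO', hOB', -⟩ := ne_of_not_collinear hn'
  obtain ⟨A₁, hA₁, dA⟩ := exists_d_ray hAO'.symm O A
  obtain ⟨B₁, hB₁, dB⟩ := exists_d_ray hOB' O B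
  obtain ⟨C₁, hC₁, dC⟩ := exists_d_ray hC'.ne.2.1 O C
  have nA := (ne_of_d dA.symm hAO.symm).symm
  have nB := (ne_of_d dB.symm hOB).symm
  have nC := (ne_of_d dC.symm hC.ne.2.1).symm
  have hb := btw_of_ray hC' hA₁ nA hC₁ nC
  have hnC : ¬ Collinear C O B := not_collinear_of_btw hn hC
  have hnC' : ¬ Collinear C' O' B' := not_collinear_of_btw hn' hC'
  have rot : ∀ {X Y Z : E}, ¬ Collinear X Y Z → ¬ Collinear Z Y X := fun h h' =>
    h (collinear_rotate (collinear_rotate (collinear_swap h')))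
  have m1 := not_collinear_of_ray hn' hA₁ nA
  have m2 := rot (not_collinear_of_ray (rot m1) hB₁ nB)
  have e1 : angle A₁ O' B₁ = angle A' O' B' := by
    rw [angle_comm, angle_ray (rot m1) hB₁ nB, angle_comm, angle_ray hn' hA₁ nA]
  have p1 := not_collinear_of_ray hnC' hC₁ nC
  have p2 := rot (not_collinear_of_ray (rot p1) hB₁ nB)
  have e2 : angle C₁ O' B₁ = angle C' O' B' := by
    rw [angle_comm, angle_ray (rot p1) hB₁ nB, angle_comm, angle_ray hnC' hC₁ nC]
  rw [← e1] at h
  rw [← e2]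
  -- After equalizing lengths, three SAS comparisons transfer the angle: triangle AOB gives the
  -- angle at A, triangle CAB then gives the angle at C, and triangle OCB gives the supplement at O.
  have dAB := sas hn m2 dA.symm dB.symm h
  have aA := sas_angle hn m2 dA.symm dB.symm h
  have dAC := d_add hC hb (by rw [d_comm, ← dA, d_comm]) dC.symm
  have col : ∀ {X Y Z W : E}, ¬ Collinear X Y Z → Btw X Y W → ¬ Collinear W X Z := by
    rintro X Y Z W hn h ⟨l, hl, l1, l2, l3⟩
    exact hn ⟨l, hl, l2, h.mem_mid hl l2 l1, l3⟩
  have q1 : ¬ Collinear C A B := col hn hC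
  have q2 : ¬ Collinear C₁ A₁ B₁ := col m2 hb
  have aA' : AngCong (angle C A B) (angle C₁ A₁ B₁) := by
    rw [← angle_ray q1 (Or.inr (Or.inr (Or.inl hC)) : O ∈ ray A C) hAO.symm,
      ← angle_ray q2 (Or.inr (Or.inr (Or.inl hb)) : O' ∈ ray A₁ C₁) nA.symm]
    exact aA
  have dCB := sas q1 q2 dAC dAB aA'
  have aC := sas_angle q1 q2 dAC dAB aA'
  have r1 : ¬ Collinear O C B := fun h => hnC (collinear_swap h)
  have r2 : ¬ Collinear O' C₁ B₁ := fun h => p2 (collinear_swap h)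
  have s1 : ¬ Collinear A C B := fun h => q1 (collinear_swap h)
  have s2 : ¬ Collinear A₁ C₁ B₁ := fun h => q2 (collinear_swap h)
  have aC' : AngCong (angle O C B) (angle O' C₁ B₁) := by
    rw [angle_ray s1 (Or.inr (Or.inr (Or.inl hC.symm)) : O ∈ ray C A) hC.ne.2.1,
      angle_ray s2 (Or.inr (Or.inr (Or.inl hb.symm)) : O' ∈ ray C₁ A₁) hb.ne.2.1]
    exact aC
  exact sas_angle r1 r2 (by rw [d_comm, ← dC, d_comm]) dCB aC'

theorem collinear_rev {A B C : E} (h : Collinear A B C) : Collinear C B A :=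
  collinear_swap (collinear_rotate h)

theorem angle_rays {A O B A' B' : E} (hn : ¬ Collinear A O B) (hA' : A' ∈ ray O A) (hne : A' ≠ O)
    (hB' : B' ∈ ray O B) (hne' : B' ≠ O) : angle A' O B' = angle A O B := by
  have h1 := not_collinear_of_ray hn hA' hne
  rw [angle_comm, angle_ray (fun h => h1 (collinear_rev h)) hB' hne', angle_comm,
    angle_ray hn hA' hne]

/-- The base angles of an isosceles triangle. -/
theorem isosceles {O A B : E} (hn : ¬ Collinear A O B) (h : d O A = d O B) :
    AngCong (angle O A B) (angle O B A) := by
  -- The triangle is compared with itself, its two legs interchanged.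
  refine sas_angle hn (fun h => hn (collinear_rev h)) h h.symm ?_
  rw [angle_comm B]
  exact angCong_refl A O B hn

theorem not_collinear_of_mem {a : Set E} (ha : IsLine a) {P Q X : E} (hP : P ∈ a) (hQ : Q ∈ a)
    (h : P ≠ Q) (hX : X ∉ a) : ¬ Collinear P Q X :=
  fun hc => hX ((collinear_iff_mem ha h hP hQ).1 hc)

/-- Betweenness is determined by the three distances. -/
theorem btw_of_d {A B C K L M : E} (h : Btw A B C) (h1 : d A B = d K L) (h2 : d B C = d L M)
    (h3 : d A C = d K M) : Btw K L M := by
  by_cases hc : Collinear K L M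
  · exact btw_of_d_of_collinear h hc h1 h2 h3
  exfalso
  -- Let N divide KM as B divides AC. The triangles KNL and MNL are isosceles. The base angles of
  -- the first, passed to supplements, and those of the second put M and the prolongation D of KL on
  -- the same ray from L, so K, L, M are collinear after all.
  obtain ⟨N, hN, h4, h5⟩ := exists_btw_copy h h3
  obtain ⟨l, hl, hKl, hNl, hMl⟩ := hN.col
  have hLl : L ∉ l := fun h => hc ⟨l, hl, hKl, h, hMl⟩
  have hLN : L ≠ N := fun e => hLl (e ▸ hNl)
  have n1 : ¬ Collinear L K N := fun h =>
    not_collinear_of_mem hl hKl hNl hN.ne.1 hLl (collinear_rotate h)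
  have n2 : ¬ Collinear N M L := not_collinear_of_mem hl hNl hMl hN.ne.2.1 hLl
  have i1 : AngCong (angle K N L) (angle K L N) :=
    isosceles (fun h => n1 (collinear_rev h)) (h4.symm.trans h1)
  have i2 : AngCong (angle M N L) (angle M L N) :=
    isosceles n2 (by rw [d_comm, ← h5, h2, d_comm])
  obtain ⟨D, hD⟩ := btw_extend K L (ne_of_d h1 h.ne.1)
  have n3 : ¬ Collinear K N L := not_collinear_of_mem hl hKl hNl hN.ne.1 hLl
  have s := supplement n3 (fun h => n1 (collinear_swap h)) i1 hN hD
  rw [angle_comm D] at s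
  rw [angle_comm M L] at i2
  obtain ⟨m, hm, hLm, hNm⟩ := exists_line hLN
  have hKm : K ∉ m := fun h => n3 ⟨m, hm, h, hNm, hLm⟩
  have hMm : M ∉ m := fun h => hKm (hN.mem_left hm hNm h)
  have hDm : D ∉ m := fun h => hKm (hD.mem_left hm hLm h)
  obtain ⟨α, hα, hmα, hKα⟩ := exists_plane_line hm hKm
  have hMα := (flat_plane hα).mem_right hN hKα (hmα hNm)
  have hDα := (flat_plane hα).mem_right hD hKα (hmα hLm)
  have ho : ¬ Opp m M D := fun h' => (separates_line hα hm hmα).two hMα hKα hDα hMm hKm hDm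
    ⟨N, hNm, hN.symm⟩ ⟨L, hLm, hD⟩ h'
  have hr := angle_layoff_unique (fun h => n2 (collinear_swap h)) hα hm hmα hLm hNm hLN hMα hMm
    hDα hDm ho i2 s
  obtain ⟨k, hk, hLk, hMk⟩ := exists_line (ne_of_not_collinear hc).2.1
  have hDk := (flat_line hk).mem_of_ray hr hLk hMk
  exact hc ⟨k, hk, hD.mem_left hk hLk hDk, hLk, hMk⟩

/-! ### Congruent mappings -/

/-- `f` maps `S` to `T` and preserves distances on `S`. -/
structure IsoMap (S T : Set E) (f : E → E) : Prop where
  maps : ∀ {P : E}, P ∈ S → f P ∈ T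
  iso : ∀ {P Q : E}, P ∈ S → Q ∈ S → d (f P) (f Q) = d P Q

theorem IsoMap.ne {S T : Set E} {f : E → E} (hf : IsoMap S T f) {P Q : E} (hP : P ∈ S)
    (hQ : Q ∈ S) (h : P ≠ Q) : f P ≠ f Q :=
  ne_of_d (hf.iso hP hQ).symm h

theorem IsoMap.btw {S T : Set E} {f : E → E} (hf : IsoMap S T f) {P Q R : E} (hP : P ∈ S)
    (hQ : Q ∈ S) (hR : R ∈ S) (h : Btw P Q R) : Btw (f P) (f Q) (f R) :=
  btw_of_d h (hf.iso hP hQ).symm (hf.iso hQ hR).symm (hf.iso hP hR).symm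

theorem IsoMap.mono {S T S' T' : Set E} {f : E → E} (hf : IsoMap S T f) (h : S' ⊆ S)
    (h' : ∀ P ∈ S', f P ∈ T') : IsoMap S' T' f :=
  ⟨fun hP => h' _ hP, fun hP hQ => hf.iso (h hP) (h hQ)⟩

theorem IsoMap.ray {S T : Set E} {f : E → E} (hf : IsoMap S T f) {O P Q : E} (hO : O ∈ S)
    (hP : P ∈ S) (hQ : Q ∈ S) (h : Q ∈ ray O P) : f Q ∈ ray (f O) (f P) := by
  rcases h with h | h | h | h
  · rw [h]; exact Or.inl rfl
  · rw [h]; exact mem_ray_self _ _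
  · exact Or.inr (Or.inr (Or.inl (hf.btw hO hQ hP h)))
  · exact Or.inr (Or.inr (Or.inr (hf.btw hO hP hQ h)))

theorem isoMap_id (S : Set E) : IsoMap S S id := ⟨fun h => h, fun _ _ => rfl⟩

/-- The point `X'` lies with respect to the image of `a` as `X` lies with respect to `a`. -/
structure Match (a : Set E) (f : E → E) (X X' : E) : Prop where
  ang : ∀ {P Q : E}, P ∈ a → Q ∈ a → P ≠ Q → AngCong (angle Q P X) (angle (f Q) (f P) X')
  dist : ∀ {P : E}, P ∈ a → d P X = d (f P) X'

section

variable {a b : Set E} {f : E → E}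

theorem angle_along (ha : IsLine a) (hb : IsLine b) (hf : IsoMap a b f) {O M P X X' : E}
    (hO : O ∈ a) (hM : M ∈ a) (hP : P ∈ a) (hOM : O ≠ M) (hOP : O ≠ P) (hX : X ∉ a) (hX' : X' ∉ b)
    (h : AngCong (angle M O X) (angle (f M) (f O) X')) :
    AngCong (angle P O X) (angle (f P) (f O) X') := by
  have n1 := not_collinear_of_mem ha hM hO hOM.symm hX
  have n2 := not_collinear_of_mem hb (hf.maps hM) (hf.maps hO) (hf.ne hM hO hOM.symm) hX'
  rcases mem_ray_or_btw ha hO hM hP hOM with h' | h'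
  · rw [angle_ray n1 h' hOP.symm, angle_ray n2 (hf.ray hO hM hP h') (hf.ne hP hO hOP.symm)]
    exact h
  · exact supplement n1 n2 h h' (hf.btw hM hO hP h')

/-- One angle and one distance at O suffice: `angle_along` turns the angle toward any P on the line,
and SAS for the triangle POX gives the angle and the distance at P. -/
theorem match_of_angle (ha : IsLine a) (hb : IsLine b) (hf : IsoMap a b f) {O M X X' : E}
    (hO : O ∈ a) (hM : M ∈ a) (hOM : O ≠ M) (hX : X ∉ a) (hX' : X' ∉ b)
    (h : AngCong (angle M O X) (angle (f M) (f O) X')) (hd : d O X = d (f O) X') :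
    Match a f X X' := by
  have key : ∀ {P : E}, P ∈ a → O ≠ P →
      AngCong (angle O P X) (angle (f O) (f P) X') ∧ d P X = d (f P) X' := by
    intro P hP hOP
    have h1 := angle_along ha hb hf hO hM hP hOM hOP hX hX' h
    have n1 := not_collinear_of_mem ha hP hO hOP.symm hX
    have n2 := not_collinear_of_mem hb (hf.maps hP) (hf.maps hO) (hf.ne hP hO hOP.symm) hX'
    have h2 := (hf.iso hO hP).symm
    exact ⟨sas_angle n1 n2 h2 hd h1, sas n1 n2 h2 hd h1⟩
  constructor
  · intro P Q hP hQ hPQ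
    by_cases hOP : O = P
    · subst hOP
      exact angle_along ha hb hf hO hM hQ hOM hPQ hX hX' h
    · exact angle_along ha hb hf hP hO hQ (Ne.symm hOP) hPQ hX hX' (key hP hOP).1
  · intro P hP
    by_cases hOP : O = P
    · exact hOP ▸ hd
    · exact (key hP hOP).2

theorem exists_match (ha : IsLine a) (hb : IsLine b) (hf : IsoMap a b f) {β : Set E}
    (hβ : IsPlane β) (hbβ : b ⊆ β) {X Y : E} (hX : X ∉ a) (hY : Y ∈ β) (hYb : Y ∉ b) :
    ∃ X' ∈ β, X' ∉ b ∧ ¬ Opp b Y X' ∧ Match a f X X' := by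
  obtain ⟨O, hO, M, hM, hOM⟩ := line_two_points a ha
  obtain ⟨N, hN, hNb, ho, hN1⟩ := exists_angle_layoff (not_collinear_of_mem ha hM hO hOM.symm hX)
    hβ hb hbβ (hf.maps hO) (hf.maps hM) (hf.ne hO hM hOM) hY hYb
  have hON : f O ≠ N := fun h => hNb (h ▸ hf.maps hO)
  obtain ⟨X', hX', hd⟩ := exists_d_ray hON O X
  have hne := ne_of_d hd.symm (fun h => hX (h ▸ hO))
  have hXb := (flat_line hb).notMem_of_ray hX' hne.symm (hf.maps hO) hNb
  have hXβ := (flat_plane hβ).mem_of_ray hX' (hbβ (hf.maps hO)) hN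
  refine ⟨X', hXβ, hXb, ?_, match_of_angle ha hb hf hO hM hOM hX hXb ?_ hd.symm⟩
  · have h1 := (flat_line hb).not_opp_of_ray hX' (hf.maps hO) hNb
    exact ((separates_line hβ hb hbβ).same hY hN hXβ hYb hNb hXb ho).not.2 h1
  · rw [angle_rays (not_collinear_of_mem hb (hf.maps hM) (hf.maps hO) (hf.ne hM hO hOM.symm) hNb)
      (mem_ray_self _ _) (hf.ne hM hO hOM.symm) hX' hne.symm]
    exact hN1

theorem match_unique (ha : IsLine a) (hb : IsLine b) (hf : IsoMap a b f) {β : Set E}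
    (hβ : IsPlane β) (hbβ : b ⊆ β) {X Y Z : E} (hX : X ∉ a) (hY : Y ∈ β) (hYb : Y ∉ b)
    (hZ : Z ∈ β) (hZb : Z ∉ b) (ho : ¬ Opp b Y Z) (h1 : Match a f X Y) (h2 : Match a f X Z) :
    Y = Z := by
  obtain ⟨O, hO, M, hM, hOM⟩ := line_two_points a ha
  have hr := angle_layoff_unique (not_collinear_of_mem ha hM hO hOM.symm hX) hβ hb hbβ
    (hf.maps hO) (hf.maps hM) (hf.ne hO hM hOM) hY hYb hZ hZb ho (h1.ang hO hM hOM)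
    (h2.ang hO hM hOM)
  exact eq_of_d_ray (fun h : f O = Y => hYb (h ▸ hf.maps hO)) (mem_ray_self _ _) hr
    ((h1.dist hO).symm.trans (h2.dist hO))

/-- Matching survives prolongation through a point of the line, because the angles on the other side
are supplements. -/
theorem match_of_btw (ha : IsLine a) (hb : IsLine b) (hf : IsoMap a b f) {X X' O W W' : E}
    (hX : X ∉ a) (hX' : X' ∉ b) (h : Match a f X X') (hO : O ∈ a) (h1 : Btw X O W)
    (h2 : Btw X' (f O) W') (hd : d (f O) W' = d O W) : W ∉ a ∧ W' ∉ b ∧ Match a f W W' := by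
  have hW : W ∉ a := fun h => hX ((flat_line ha).mem_left h1 hO h)
  have hW' : W' ∉ b := fun h => hX' ((flat_line hb).mem_left h2 (hf.maps hO) h)
  obtain ⟨M, hM, hMO⟩ := exists_ne_mem ha O
  refine ⟨hW, hW', match_of_angle ha hb hf hO hM hMO.symm hW hW' ?_ hd.symm⟩
  have n1 := not_collinear_of_mem ha hM hO hMO hX
  have n2 := not_collinear_of_mem hb (hf.maps hM) (hf.maps hO) (hf.ne hM hO hMO) hX'
  have h3 := h.ang hO hM hMO.symm
  rw [angle_comm M, angle_comm (f M)] at h3 ⊢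
  exact supplement (fun h => n1 (collinear_rev h)) (fun h => n2 (collinear_rev h)) h3 h1 h2

theorem exists_opp {U S : Set E} (hU : Flat U) (hS : Flat S) {O Y : E} (hOU : O ∈ U)
    (hO : O ∈ S) (hY : Y ∈ U) (hYS : Y ∉ S) : ∃ Z ∈ U, Z ∉ S ∧ Opp S Y Z := by
  obtain ⟨Z, hZ⟩ := btw_extend Y O (fun h => hYS (h ▸ hO))
  exact ⟨Z, hU.mem_right hZ hY hOU, fun h => hYS (hS.mem_left hZ hO h), O, hO, hZ⟩

/-- Prolong X'f(Q) by the length of QY. The end point matches Y and lies on the side of Y', so it is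
Y', and the two parts of the segment add up. -/
theorem match_opp (ha : IsLine a) (hb : IsLine b) (hf : IsoMap a b f) {β : Set E}
    (hβ : IsPlane β) (hbβ : b ⊆ β) {X X' Y Y' Q : E} (hX : X ∉ a) (hY : Y ∉ a) (hXβ : X' ∈ β)
    (hXb : X' ∉ b) (hYβ : Y' ∈ β) (hYb : Y' ∉ b) (hQ : Q ∈ a) (h : Btw X Q Y) (ho : Opp b X' Y')
    (h1 : Match a f X X') (h2 : Match a f Y Y') : Btw X' (f Q) Y' ∧ d X' Y' = d X Y := by
  have hQb := hf.maps hQ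
  obtain ⟨Z, hZ, hd⟩ := exists_btw_d (fun e => hXb (e ▸ hQb) : X' ≠ f Q) h.ne.2.1
  obtain ⟨-, hZb, h3⟩ := match_of_btw ha hb hf hX hXb h1 hQ h hZ hd
  have hZβ := (flat_plane hβ).mem_right hZ hXβ (hbβ hQb)
  have ho' : ¬ Opp b Z Y' := ((separates_line hβ hb hbβ).opp hXβ hZβ hYβ hXb hZb hYb
    ⟨f Q, hQb, hZ⟩).1 ho
  have e := match_unique ha hb hf hβ hbβ hY hZβ hZb hYβ hYb ho' h3 h2
  subst e
  exact ⟨hZ, d_add hZ h (by rw [d_comm, ← h1.dist hQ, d_comm]) hd⟩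

/-- Prolong XO to a point W beyond a. Then W and Y are separated by a, which gives the distance WY;
SAS in the triangle XWY yields XY. Taking O off the line XY keeps this triangle nondegenerate. -/
theorem match_same (ha : IsLine a) (hb : IsLine b) (hf : IsoMap a b f) {α β : Set E}
    (hα : IsPlane α) (haα : a ⊆ α) (hβ : IsPlane β) (hbβ : b ⊆ β) {X X' Y Y' : E}
    (hXα : X ∈ α) (hX : X ∉ a) (hYα : Y ∈ α) (hY : Y ∉ a) (hXβ : X' ∈ β) (hXb : X' ∉ b)
    (hYβ : Y' ∈ β) (hYb : Y' ∉ b) (ho : ¬ Opp a X Y) (ho' : ¬ Opp b X' Y')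
    (h1 : Match a f X X') (h2 : Match a f Y Y') : d X' Y' = d X Y := by
  by_cases hXY : X = Y
  · subst hXY
    rw [match_unique ha hb hf hβ hbβ hX hXβ hXb hYβ hYb ho' h1 h2]
    exact d_self _ _
  obtain ⟨l, hl, hXl, hYl⟩ := exists_line hXY
  obtain ⟨O, hO, hOl⟩ : ∃ O ∈ a, O ∉ l := by
    obtain ⟨P, hP, Q, hQ, hPQ⟩ := line_two_points a ha
    by_cases h : P ∈ l
    · exact ⟨Q, hQ, fun h' => hPQ ((flat_line ha).unique hl hXl hX h hP h' hQ)⟩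
    · exact ⟨P, hP, h⟩
  have hOX : X ≠ O := fun h => hX (h ▸ hO)
  have hOb := hf.maps hO
  obtain ⟨W, hW⟩ := btw_extend X O hOX
  obtain ⟨W', hW', hd⟩ := exists_btw_d (fun e => hXb (e ▸ hOb) : X' ≠ f O) hW.ne.2.1
  obtain ⟨hWa, hWb, h3⟩ := match_of_btw ha hb hf hX hXb h1 hO hW hW' hd
  have hWα := (flat_plane hα).mem_right hW hXα (haα hO)
  have hWβ := (flat_plane hβ).mem_right hW' hXβ (hbβ hOb)
  have o1 : Opp a W Y := by
    rw [opp_comm, ← (separates_line hα ha haα).same hXα hYα hWα hX hY hWa ho]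
    exact ⟨O, hO, hW⟩
  have o2 : Opp b W' Y' := by
    rw [opp_comm, ← (separates_line hβ hb hbβ).same hXβ hYβ hWβ hXb hYb hWb ho']
    exact ⟨f O, hOb, hW'⟩
  obtain ⟨Q, hQ, hWQ⟩ := o1
  have hQb := hf.maps hQ
  obtain ⟨hWQ', hdW⟩ := match_opp ha hb hf hβ hbβ hWa hY hWβ hWb hYβ hYb hQ hWQ o2 h3 h2
  have hQO : Q ≠ O := by
    rintro rfl
    obtain ⟨m, hm, m1, m2, m3⟩ := hW.col
    exact hOl (line_ext hm hl m1 (hWQ.mem_right hm m3 m2) hXl hYl hXY ▸ m2)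
  have n1 : ¬ Collinear X W Y := by
    rintro ⟨m, hm, m1, m2, m3⟩
    exact hWa (line_ext hm ha (hW.mem_mid hm m1 m2) (hWQ.mem_mid hm m2 m3) hO hQ hQO.symm ▸ m2)
  have n2 : ¬ Collinear X' W' Y' := by
    rintro ⟨m, hm, m1, m2, m3⟩
    exact hWb (line_ext hm hb (hW'.mem_mid hm m1 m2) (hWQ'.mem_mid hm m2 m3) hOb hQb
      (hf.ne hO hQ hQO.symm) ▸ m2)
  -- The angle of the triangle XWY at W is that of the triangle QWO, whose side QO lies on a, where
  -- f already preserves distances.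
  have a1 : AngCong (angle Q W O) (angle (f Q) W' (f O)) := by
    refine sas_angle (O := Q) (A := W) (B := O) (fun h => not_collinear_of_mem ha hQ hO hQO hWa
      (collinear_rotate h)) (fun h => not_collinear_of_mem hb hQb hOb (hf.ne hQ hO hQO) hWb
      (collinear_rotate h)) (h3.dist hQ) (hf.iso hQ hO).symm ?_
    rw [angle_comm W, angle_comm W']
    exact h3.ang hQ hO hQO
  rw [angle_comm Q, angle_comm (f Q),
    angle_rays n1 (Or.inr (Or.inr (Or.inl hW.symm))) hW.ne.2.1
      (Or.inr (Or.inr (Or.inl hWQ))) hWQ.ne.1.symm,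
    angle_rays n2 (Or.inr (Or.inr (Or.inl hW'.symm))) hW'.ne.2.1
      (Or.inr (Or.inr (Or.inl hWQ'))) hWQ'.ne.1.symm] at a1
  refine (sas n1 n2 ?_ hdW.symm a1).symm
  exact d_add hW.symm hW'.symm (by rw [d_comm, ← hd, d_comm]) (h1.dist hO)

/-- The extension of a congruent mapping from a line to a plane. -/
theorem exists_plane_extension (ha : IsLine a) (hb : IsLine b) (hf : IsoMap a b f) {α β : Set E}
    (hα : IsPlane α) (haα : a ⊆ α) (hβ : IsPlane β) (hbβ : b ⊆ β) {X₀ Y₀ : E} (hX₀ : X₀ ∈ α)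
    (hX₀a : X₀ ∉ a) (hY₀ : Y₀ ∈ β) (hY₀b : Y₀ ∉ b) :
    ∃ F : E → E, IsoMap α β F ∧ (∀ P ∈ a, F P = f P) ∧
      ∀ X ∈ α, X ∉ a → F X ∉ b ∧ Match a f X (F X) ∧ (Opp a X₀ X ↔ Opp b Y₀ (F X)) := by
  have sα := separates_line hα ha haα
  have sβ := separates_line hβ hb hbβ
  obtain ⟨O, hO, -⟩ := line_two_points a ha
  -- Y₁ represents the half-plane opposite to that of Y₀, the target of the points separated from
  -- X₀.
  obtain ⟨Y₁, hY₁, hY₁b, ho⟩ := exists_opp (flat_plane hβ) (flat_line hb) (hbβ (hf.maps hO))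
    (hf.maps hO) hY₀ hY₀b
  have key : ∀ X : E, ∃ X' : E, (X ∈ a → X' = f X) ∧ (X ∈ α → X ∉ a →
      X' ∈ β ∧ X' ∉ b ∧ Match a f X X' ∧ (Opp a X₀ X ↔ Opp b Y₀ X')) := by
    intro X
    by_cases hX : X ∈ a
    · exact ⟨f X, fun _ => rfl, fun _ h => absurd hX h⟩
    by_cases hXα : X ∈ α
    · by_cases hXX : Opp a X₀ X
      · obtain ⟨X', h1, h2, h3, h4⟩ := exists_match ha hb hf hβ hbβ hX hY₁ hY₁b
        exact ⟨X', fun h => absurd h hX, fun _ _ => ⟨h1, h2, h4, iff_of_true hXX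
          ((sβ.opp hY₀ hY₁ h1 hY₀b hY₁b h2 ho).2 h3)⟩⟩
      · obtain ⟨X', h1, h2, h3, h4⟩ := exists_match ha hb hf hβ hbβ hX hY₀ hY₀b
        exact ⟨X', fun h => absurd h hX, fun _ _ => ⟨h1, h2, h4, iff_of_false hXX h3⟩⟩
    · exact ⟨f X, fun h => absurd h hX, fun h => absurd h hXα⟩
  choose F hF1 hF2 using key
  refine ⟨F, ⟨?_, ?_⟩, hF1, fun X hX hXa => (hF2 X hX hXa).2⟩
  · intro X hX
    by_cases hXa : X ∈ a
    · rw [hF1 X hXa]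
      exact hbβ (hf.maps hXa)
    · exact (hF2 X hX hXa).1
  · intro X Y hX hY
    by_cases hXa : X ∈ a
    · rw [hF1 X hXa]
      by_cases hYa : Y ∈ a
      · rw [hF1 Y hYa]
        exact hf.iso hXa hYa
      · exact ((hF2 Y hY hYa).2.2.1.dist hXa).symm
    · obtain ⟨h1, h2, h3, h4⟩ := hF2 X hX hXa
      by_cases hYa : Y ∈ a
      · rw [hF1 Y hYa, d_comm, d_comm X]
        exact (h3.dist hYa).symm
      · obtain ⟨k1, k2, k3, k4⟩ := hF2 Y hY hYa
        have hiff : Opp a X Y ↔ Opp b (F X) (F Y) := by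
          by_cases hXX : Opp a X₀ X
          · have e1 := sα.opp hX₀ hX hY hX₀a hXa hYa hXX
            have e2 := sβ.opp hY₀ h1 k1 hY₀b h2 k2 (h4.1 hXX)
            tauto
          · have e1 := sα.same hX₀ hX hY hX₀a hXa hYa hXX
            have e2 := sβ.same hY₀ h1 k1 hY₀b h2 k2 (fun h => hXX (h4.2 h))
            tauto
        by_cases hXY : Opp a X Y
        · obtain ⟨Q, hQ, hXY'⟩ := id hXY
          exact (match_opp ha hb hf hβ hbβ hXa hYa h1 h2 k1 k2 hQ hXY' (hiff.1 hXY) h3 k3).2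
        · exact match_same ha hb hf hα haα hβ hbβ hX hXa hY hYa h1 h2 k1 k2 hXY
            (fun h => hXY (hiff.2 h)) h3 k3

end

/-! ### Congruent mappings of lines -/

/-- A point of a line is determined by its distances from two points of the line. -/
theorem eq_of_d_line {l : Set E} (hl : IsLine l) {O M P Y : E} (hO : O ∈ l) (hM : M ∈ l)
    (hP : P ∈ l) (h : O ≠ M) (h1 : d O Y = d O P) (h2 : d M Y = d M P) : Y = P := by
  rcases mem_ray_or_btw hl hO hM hP h with h' | h'
  · rcases id h' with rfl | rfl | h3 | h3
    · exact ((eq_iff_of_d h1).2 rfl).symm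
    · exact ((eq_iff_of_d h2).2 rfl).symm
    · exact eq_of_d_ray h (Or.inr (Or.inr (Or.inl (btw_of_d h3 h1.symm
        (by rw [d_comm, ← h2, d_comm]) rfl)))) h' h1
    · exact eq_of_d_ray h (Or.inr (Or.inr (Or.inr (btw_of_d h3 rfl h2.symm h1.symm)))) h' h1
  · exact eq_of_d_ray h.symm (Or.inr (Or.inr (Or.inr (btw_of_d h' rfl h1.symm h2.symm))))
      (Or.inr (Or.inr (Or.inr h'))) h2

theorem IsoMap.exists_line {a T : Set E} (ha : IsLine a) {f : E → E} (hf : IsoMap a T f) :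
    ∃ b, IsLine b ∧ IsoMap a b f := by
  obtain ⟨A, hA, B, hB, hAB⟩ := line_two_points a ha
  obtain ⟨b, hb, h1, h2⟩ := AbsoluteSpace.exists_line (hf.ne hA hB hAB)
  refine ⟨b, hb, hf.mono subset_rfl ?_⟩
  intro P hP
  rcases mem_ray_or_btw ha hA hB hP hAB with h | h
  · exact (flat_line hb).mem_of_ray (hf.ray hA hB hP h) h1 h2
  · exact (hf.btw hB hA hP h).mem_right hb h2 h1

theorem IsoMap.surj_line {a b : Set E} (ha : IsLine a) (hb : IsLine b) {f : E → E}
    (hf : IsoMap a b f) {Q : E} (hQ : Q ∈ b) : ∃ P ∈ a, f P = Q := by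
  obtain ⟨A, hA, B, hB, hAB⟩ := line_two_points a ha
  have hne := hf.ne hA hB hAB
  rcases mem_ray_or_btw hb (hf.maps hA) (hf.maps hB) hQ hne with h | h
  · obtain ⟨P, hP, hd⟩ := exists_d_ray hAB (f A) Q
    have hPa := (flat_line ha).mem_of_ray hP hA hB
    exact ⟨P, hPa, eq_of_d_ray hne (hf.ray hA hB hPa hP) h ((hf.iso hA hPa).trans hd)⟩
  · obtain ⟨P, hP, hd⟩ := exists_btw_d hAB.symm h.ne.2.1
    have hPa := hP.mem_right ha hB hA
    have hP' := hf.btw hB hA hPa hP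
    exact ⟨P, hPa, eq_of_d_ray hne.symm (Or.inr (Or.inr (Or.inr hP')))
      (Or.inr (Or.inr (Or.inr h))) (d_add hP' h rfl ((hf.iso hA hPa).trans hd))⟩

theorem mem_ray_of_mem_ray {A B P Q : E} (hAB : A ≠ B) (hP : P ∈ ray A B) (hQ : Q ∈ ray A B)
    (hPA : P ≠ A) : Q ∈ ray A P := by
  obtain ⟨l, hl, hA, hB⟩ := exists_line hAB
  rcases mem_ray_or_btw hl hA ((flat_line hl).mem_of_ray hP hA hB)
    ((flat_line hl).mem_of_ray hQ hA hB) hPA.symm with h | h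
  · exact h
  · exact absurd rfl (btw_of_ray h (mem_ray_symm hP hPA) hAB.symm
      (mem_ray_symm hQ h.ne.2.1.symm) hAB.symm).ne.2.2

theorem d_of_rays {A B P Q A' B' P' Q' : E} (hAB : A ≠ B) (hAB' : A' ≠ B') (hP : P ∈ ray A B)
    (hQ : Q ∈ ray A B) (hP' : P' ∈ ray A' B') (hQ' : Q' ∈ ray A' B') (h1 : d A P = d A' P')
    (h2 : d A Q = d A' Q') : d P Q = d P' Q' := by
  by_cases hPA : A = P
  · rw [← hPA, ← (eq_iff_of_d h1).1 hPA, h2]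
  by_cases hQA : A = Q
  · rw [← hQA, ← (eq_iff_of_d h2).1 hQA, d_comm, h1, d_comm]
  have hPA' := ne_of_d h1 hPA
  have hQA' := ne_of_d h2 hQA
  rcases mem_ray_of_mem_ray hAB hP hQ (Ne.symm hPA) with h | h | h | h
  · exact absurd h.symm hQA
  · subst h
    rw [eq_of_d_ray hAB' hP' hQ' (h1.symm.trans h2)]
    exact d_self _ _
  · rw [d_comm, d_comm P']
    exact d_sub h (btw_of_d_of_ray h (mem_ray_of_mem_ray hAB' hP' hQ' hPA'.symm) h2 h1) h2 h1
  · exact d_sub h (btw_of_d_of_ray h (mem_ray_of_mem_ray hAB' hQ' hP' hQA'.symm) h1 h2) h1 h2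

/-- Each point is laid off at its distance from A, on the ray toward B' or on the opposite one as
its own position demands; addition and subtraction of segments give the remaining distances. -/
theorem exists_line_isoMap {a b : Set E} (ha : IsLine a) (hb : IsLine b) {A B A' B' : E}
    (hA : A ∈ a) (hB : B ∈ a) (hA' : A' ∈ b) (hB' : B' ∈ b) (hAB : A ≠ B) (h : d A B = d A' B') :
    ∃ f : E → E, IsoMap a b f ∧ f A = A' ∧ f B = B' := by
  have hAB' := ne_of_d h hAB
  have key : ∀ P : E, ∃ P' : E, P ∈ a → P' ∈ b ∧ d A P = d A' P' ∧
      ((P ∈ ray A B ∧ P' ∈ ray A' B') ∨ (Btw B A P ∧ Btw B' A' P')) := by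
    intro P
    by_cases hP : P ∈ a
    · rcases mem_ray_or_btw ha hA hB hP hAB with h1 | h1
      · obtain ⟨Q, hQ, hd⟩ := exists_d_ray hAB' A P
        exact ⟨Q, fun _ => ⟨(flat_line hb).mem_of_ray hQ hA' hB', hd.symm, Or.inl ⟨h1, hQ⟩⟩⟩
      · obtain ⟨Q, hQ, hd⟩ := exists_btw_d hAB'.symm h1.ne.2.1
        exact ⟨Q, fun _ => ⟨hQ.mem_right hb hB' hA', hd.symm, Or.inr ⟨h1, hQ⟩⟩⟩
    · exact ⟨P, fun h => absurd h hP⟩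
  choose f hf using key
  have mixed : ∀ {P Q : E}, P ∈ a → Q ∈ a → P ∈ ray A B → f P ∈ ray A' B' → Btw B A Q →
      Btw B' A' (f Q) → d (f P) (f Q) = d P Q := by
    intro P Q hP hQ p1 p2 q1 q2
    obtain ⟨-, dP, -⟩ := hf P hP
    obtain ⟨-, dQ, -⟩ := hf Q hQ
    by_cases hPA : A = P
    · rw [← (eq_iff_of_d dP).1 hPA, ← hPA]
      exact dQ.symm
    · exact d_add (btw_of_ray q2 p2 (ne_of_d dP hPA).symm (mem_ray_self _ _) q2.ne.2.1.symm)
        (btw_of_ray q1 p1 (Ne.symm hPA) (mem_ray_self _ _) q1.ne.2.1.symm)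
        (by rw [d_comm, ← dP, d_comm]) dQ.symm
  refine ⟨f, ⟨fun hP => (hf _ hP).1, ?_⟩, ?_, ?_⟩
  · intro P Q hP hQ
    obtain ⟨-, dP, ⟨p1, p2⟩ | ⟨p1, p2⟩⟩ := hf P hP <;>
    obtain ⟨-, dQ, ⟨q1, q2⟩ | ⟨q1, q2⟩⟩ := hf Q hQ
    · exact (d_of_rays hAB hAB' p1 q1 p2 q2 dP dQ).symm
    · exact mixed hP hQ p1 p2 q1 q2
    · rw [d_comm, d_comm P]
      exact mixed hQ hP q1 q2 p1 p2
    · have r1 : Q ∈ ray A P := (mem_ray_or_btw ha hA hP hQ p1.ne.2.1).resolve_right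
        (p1.symm.not_btw q1.symm)
      have r2 : f Q ∈ ray A' (f P) := (mem_ray_or_btw hb hA' (p2.mem_right hb hB' hA')
        (q2.mem_right hb hB' hA') p2.ne.2.1).resolve_right (p2.symm.not_btw q2.symm)
      exact (d_of_rays p1.ne.2.1 p2.ne.2.1 (mem_ray_self _ _) r1 (mem_ray_self _ _) r2 dP dQ).symm
  · exact ((eq_iff_of_d (hf A hA).2.1).1 rfl).symm
  · obtain ⟨-, dB, ⟨-, h2⟩ | ⟨h1, -⟩⟩ := hf B hB
    · exact eq_of_d_ray hAB' h2 (mem_ray_self _ _) (dB.symm.trans h)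
    · exact absurd rfl h1.ne.2.2

/-! ### Determination of points by distances -/

/-- A point and its mirror image with respect to a line. -/
theorem match_of_mirror {b : Set E} (hb : IsLine b) {X Z : E} (hX : X ∉ b) (hZ : Z ∉ b)
    (ho : Opp b X Z) (h : ∀ P ∈ b, d P X = d P Z) : Match b id Z X := by
  obtain ⟨Q, hQ, hXQZ⟩ := ho
  obtain ⟨P, hP, hPQ⟩ := exists_ne_mem hb Q
  have n : ¬ Collinear Z P X := by
    rintro ⟨m, hm, m1, m2, m3⟩
    exact hX (line_ext hm hb m2 (hXQZ.mem_mid hm m3 m1) hP hQ hPQ ▸ m3)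
  -- Since Q lies on the base ZX of this isosceles triangle, SAS for ZPQ and XPQ gives equal angles
  -- at P, which is what a match needs.
  have i := isosceles n (h P hP).symm
  have nZ : ¬ Collinear P Z X := fun h => n (collinear_swap h)
  have nX : ¬ Collinear P X Z := fun h => n (collinear_rotate (collinear_rotate h))
  rw [← angle_rays nZ (mem_ray_self _ _) (ne_of_not_collinear nZ).1
      (Or.inr (Or.inr (Or.inl hXQZ.symm)) : Q ∈ ray Z X) hXQZ.ne.2.1,
    ← angle_rays nX (mem_ray_self _ _) (ne_of_not_collinear nX).1
      (Or.inr (Or.inr (Or.inl hXQZ)) : Q ∈ ray X Z) hXQZ.ne.1.symm] at i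
  have mZ := not_collinear_of_mem hb hP hQ hPQ hZ
  have mX := not_collinear_of_mem hb hP hQ hPQ hX
  have a1 : AngCong (angle Z P Q) (angle X P Q) := by
    refine sas_angle (O := Z) (O' := X) (fun h => mZ (collinear_rotate (collinear_swap h)))
      (fun h => mX (collinear_rotate (collinear_swap h))) ?_ ?_ i
    · rw [d_comm, ← h P hP, d_comm]
    · rw [d_comm, ← h Q hQ, d_comm]
  rw [angle_comm, angle_comm X] at a1
  exact match_of_angle hb hb (isoMap_id b) hP hQ hPQ hZ hX a1 (h P hP).symm

/-- Let Z be the mirror image of X in b. Both X and Y are mirror images of Z on the same side of b,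
and such an image is unique. -/
theorem eq_of_d_plane {β b : Set E} (hβ : IsPlane β) (hb : IsLine b) (hbβ : b ⊆ β) {X Y : E}
    (hX : X ∈ β) (hXb : X ∉ b) (hY : Y ∈ β) (hYb : Y ∉ b) (ho : ¬ Opp b X Y)
    (h : ∀ P ∈ b, d P X = d P Y) : X = Y := by
  obtain ⟨O, hO, -⟩ := line_two_points b hb
  obtain ⟨W, hW, hWb, hXW⟩ := exists_opp (flat_plane hβ) (flat_line hb) (hbβ hO) hO hX hXb
  have sβ := separates_line hβ hb hbβ
  obtain ⟨Z, hZ, hZb, hWZ, hm⟩ := exists_match hb hb (isoMap_id b) hβ hbβ hXb hW hWb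
  have hXZ : Opp b X Z := (sβ.opp hX hW hZ hXb hWb hZb hXW).2 hWZ
  have hYZ : Opp b Y Z := (sβ.same hX hY hZ hXb hYb hZb ho).1 hXZ
  exact match_unique hb hb (isoMap_id b) hβ hbβ hZb hX hXb hY hYb ho
    (match_of_mirror hb hXb hZb hXZ (fun P hP => hm.dist hP))
    (match_of_mirror hb hYb hZb hYZ (fun P hP => (h P hP).symm.trans (hm.dist hP)))

/-- The points of a plane equidistant from two points of the plane form a flat set. -/
theorem equidistant_of_coplanar {α l : Set E} (hα : IsPlane α) (hl : IsLine l) {A B O M P : E}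
    (hA : A ∈ α) (hB : B ∈ α) (hO : O ∈ α) (hM : M ∈ α) (hOl : O ∈ l) (hMl : M ∈ l) (hP : P ∈ l)
    (hOM : O ≠ M) (h1 : d O A = d O B) (h2 : d M A = d M B) : d P A = d P B := by
  by_cases hAB : A = B
  · rw [hAB]
  obtain ⟨c, hc, hAc, hBc⟩ := exists_line hAB
  have hcα := line_subset hc hα hAB hAc hBc hA hB
  -- The interchange of A and B on their line, extended with each half-plane kept, is a reflection F
  -- of the plane.
  obtain ⟨g, hg, gA, gB⟩ := exists_line_isoMap hc hc hAc hBc hBc hAc hAB (d_comm A B)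
  obtain ⟨X₀, hX₀, hX₀c⟩ := exists_mem_plane_notMem_line hα hc
  obtain ⟨F, hF, hFg, hFm⟩ := exists_plane_extension hc hc hg hα hcα hα hcα hX₀ hX₀c hX₀ hX₀c
  -- Equidistant points are fixed: off the line AB, the base angles of the isosceles triangle AQB
  -- show that Q matches itself. Then O and M, hence all of l, are fixed, while A goes to B.
  have fix : ∀ Q ∈ α, d Q A = d Q B → F Q = Q := by
    intro Q hQ h
    by_cases hQc : Q ∈ c
    · rw [hFg Q hQc]
      refine eq_of_d_line hc hAc hBc hQc hAB ?_ ?_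
      · rw [← gB, hg.iso hBc hQc, gB, d_comm, ← h, d_comm]
      · rw [← gA, hg.iso hAc hQc, gA, d_comm, h, d_comm]
    · obtain ⟨m1, m2, m3⟩ := hFm Q hQ hQc
      have n : ¬ Collinear A Q B := fun h =>
        not_collinear_of_mem hc hBc hAc (Ne.symm hAB) hQc (collinear_rotate (collinear_rotate h))
      have hm : Match c g Q Q := by
        refine match_of_angle hc hc hg hAc hBc hAB hQc hQc ?_ ?_
        · rw [gA, gB, angle_comm, angle_comm A]
          exact isosceles n h
        · rw [gA, d_comm, h, d_comm]
      refine match_unique hc hc hg hα hcα hQc (hF.maps hQ) m1 hQ hQc ?_ m2 hm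
      have := (separates_line hα hc hcα).same hX₀ (hF.maps hQ) hQ hX₀c m1 hQc
      by_cases ho : Opp c X₀ Q
      · exact ((separates_line hα hc hcα).opp hX₀ (hF.maps hQ) hQ hX₀c m1 hQc (m3.1 ho)).1 ho
      · exact (this (fun h => ho (m3.2 h))).not.1 ho
  have hPα := line_subset hl hα hOM hOl hMl hO hM hP
  have eO := fix O hO h1
  have eM := fix M hM h2
  have eP : F P = P := eq_of_d_line hl hOl hMl hP hOM (by rw [← hF.iso hO hPα, eO])
    (by rw [← hF.iso hM hPα, eM])
  have eA : F A = B := (hFg A hAc).trans gA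
  rw [← hF.iso hPα hA, eP, eA]

/-- The five segments property. -/
theorem five_segment {l : Set E} (hl : IsLine l) {A B P C A' B' P' C' : E} (hA : A ∈ l)
    (hB : B ∈ l) (hP : P ∈ l) (hAB : A ≠ B) (h1 : d A B = d A' B') (h2 : d A P = d A' P')
    (h3 : d B P = d B' P') (h4 : d A C = d A' C') (h5 : d B C = d B' C') : d P C = d P' C' := by
  have hAB' := ne_of_d h1 hAB
  obtain ⟨l', hl', hA', hB'⟩ := exists_line hAB'
  obtain ⟨g, hg, gA, gB⟩ := exists_line_isoMap hl hl' hA hB hA' hB' hAB h1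
  have det : ∀ {X X' : E}, X ∈ l → d A X = d A' X' → d B X = d B' X' → g X = X' := by
    intro X X' hX e1 e2
    refine (eq_of_d_line hl' hA' hB' (hg.maps hX) hAB' ?_ ?_).symm
    · rw [← e1, ← hg.iso hA hX, gA]
    · rw [← e2, ← hg.iso hB hX, gB]
  have gP := det hP h2 h3
  by_cases hC : C ∈ l
  · rw [← gP, ← det hC h4 h5, hg.iso hP hC]
  have hC' : C' ∉ l' := by
    intro h
    obtain ⟨Y, hY, e⟩ := hg.surj_line hl hl' h
    have : C = Y := eq_of_d_line hl hA hB hY hAB (by rw [h4, ← e, ← hg.iso hA hY, gA])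
      (by rw [h5, ← e, ← hg.iso hB hY, gB])
    exact hC (this ▸ hY)
  obtain ⟨α, hα, hlα, hCα⟩ := exists_plane_line hl hC
  obtain ⟨β, hβ, hlβ, hCβ⟩ := exists_plane_line hl' hC'
  obtain ⟨F, hF, hFg, hFm⟩ := exists_plane_extension hl hl' hg hα hlα hβ hlβ hCα hC hCβ hC'
  obtain ⟨m1, m2, m3⟩ := hFm C hCα hC
  -- F C and C' lie on one side of l' and are equidistant from A' and B', hence from every point of
  -- l'.
  have e : F C = C' := by
    refine eq_of_d_plane hβ hl' hlβ (hF.maps hCα) m1 hCβ hC'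
      (fun h => not_opp_self C (m3.2 h.symm)) ?_
    · intro Q hQ
      refine equidistant_of_coplanar hβ hl' (hF.maps hCα) hCβ (hlβ hA') (hlβ hB') hA' hB' hQ hAB'
        ?_ ?_
      · rw [← h4, ← gA, m2.dist hA]
      · rw [← h5, ← gB, m2.dist hB]
  rw [← e, ← gP, m2.dist hP]

/-- The points equidistant from two given points form a flat set. -/
theorem flat_equidistant (A B : E) : Flat {P : E | d P A = d P B} := by
  intro l hl P Q hPQ hP hQ h1 h2 R hR
  exact five_segment hl hP hQ hR hPQ rfl rfl rfl h1 h2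

/-- A flat set that contains three non-collinear points contains their plane. -/
theorem Flat.plane_subset {S : Set E} (hS : Flat S) {α : Set E} (hα : IsPlane α) {A B C : E}
    (hn : ¬ Collinear A B C) (hA : A ∈ α) (hB : B ∈ α) (hC : C ∈ α) (hAS : A ∈ S) (hBS : B ∈ S)
    (hCS : C ∈ S) : α ⊆ S := by
  intro P hP
  obtain ⟨hAB, hBC, hAC⟩ := ne_of_not_collinear hn
  obtain ⟨l, hl, hAl, hBl⟩ := exists_line hAB
  obtain ⟨m, hm, hAm, hCm⟩ := exists_line hAC
  have hlS := hS hl hAB hAl hBl hAS hBS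
  have hmS := hS hm hAC hAm hCm hAS hCS
  by_cases hPm : P ∈ m
  · exact hmS hPm
  by_cases hPl : P ∈ l
  · exact hlS hPl
  have hBm : B ∉ m := fun h => hn ⟨m, hm, hAm, h, hCm⟩
  -- B and D lie on opposite sides of m, so m separates P from one of them; P then lies on a line
  -- through a point of l and a point of m.
  obtain ⟨D, hD⟩ := btw_extend B A hAB.symm
  have hDl := hD.mem_right hl hBl hAl
  have hDm : D ∉ m := fun h => hBm (hD.mem_left hm hAm h)
  have hmα := line_subset hm hα hAC hAm hCm hA hC
  have hlα := line_subset hl hα hAB hAl hBl hA hB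
  have fin : ∀ Q ∈ l, Q ∉ m → Opp m Q P → P ∈ S := by
    rintro Q hQ hQm ⟨R, hR, h⟩
    exact hS.mem_right h (hlS hQ) (hmS hR)
  rcases (separates_line hα hm hmα).pasch hB (hlα hDl) hP hBm hDm hPm ⟨A, hAm, hD⟩ with h | h
  · exact fin B hBl hBm h
  · exact fin D hDl hDm h

/-- A point of a plane is determined by its distances from three non-collinear points of the
plane. -/
theorem eq_of_d_three {α : Set E} (hα : IsPlane α) {A B C X Y : E} (hn : ¬ Collinear A B C)
    (hA : A ∈ α) (hB : B ∈ α) (hC : C ∈ α) (hX : X ∈ α) (h1 : d A X = d A Y) (h2 : d B X = d B Y)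
    (h3 : d C X = d C Y) : X = Y := by
  -- The set equidistant from X and Y contains the whole plane, in particular X itself.
  have h : d X X = d X Y := (flat_equidistant X Y).plane_subset hα hn hA hB hC h1 h2 h3 hX
  exact (eq_iff_of_d h).1 rfl

/-- If the distances of `X` from three non-collinear points of a plane agree with those of `X'`
from their images, the same holds for all points of the plane. -/
theorem IsoMap.d_of_three {α T : Set E} (hα : IsPlane α) {f : E → E} (hf : IsoMap α T f)
    {A B C X X' : E} (hn : ¬ Collinear A B C) (hA : A ∈ α) (hB : B ∈ α) (hC : C ∈ α)
    (h1 : d A X = d (f A) X') (h2 : d B X = d (f B) X') (h3 : d C X = d (f C) X') :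
    ∀ P ∈ α, d P X = d (f P) X' := by
  have hfl : Flat {P : E | P ∈ α ∧ d P X = d (f P) X'} := by
    intro l hl P Q hPQ hP hQ p q R hR
    have hRα := flat_plane hα hl hPQ hP hQ p.1 q.1 hR
    exact ⟨hRα, five_segment hl hP hQ hR hPQ (hf.iso p.1 q.1).symm (hf.iso p.1 hRα).symm
      (hf.iso q.1 hRα).symm p.2 q.2⟩
  exact fun P hP => (hfl.plane_subset hα hn hA hB hC ⟨hA, h1⟩ ⟨hB, h2⟩ ⟨hC, h3⟩ hP).2

/-! ### Congruent mappings of planes -/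

theorem IsoMap.exists_inverse {S T : Set E} {f : E → E} (hf : IsoMap S T f)
    (hs : ∀ Q ∈ T, ∃ P ∈ S, f P = Q) :
    ∃ g : E → E, IsoMap T S g ∧ (∀ Q ∈ T, f (g Q) = Q) ∧ ∀ P ∈ S, g (f P) = P := by
  have : ∀ Q : E, ∃ P : E, Q ∈ T → P ∈ S ∧ f P = Q := by
    intro Q
    by_cases hQ : Q ∈ T
    · obtain ⟨P, h⟩ := hs Q hQ
      exact ⟨P, fun _ => h⟩
    · exact ⟨Q, fun h => absurd h hQ⟩
  choose g hg using this
  refine ⟨g, ⟨fun hQ => (hg _ hQ).1, ?_⟩, fun Q hQ => (hg Q hQ).2, ?_⟩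
  · intro P Q hP hQ
    rw [← hf.iso (hg P hP).1 (hg Q hQ).1, (hg P hP).2, (hg Q hQ).2]
  · intro P hP
    by_contra h
    obtain ⟨h1, h2⟩ := hg (f P) (hf.maps hP)
    exact hf.ne h1 hP h h2

theorem IsoMap.line_image {α β a : Set E} (hβ : IsPlane β) (ha : IsLine a) (haα : a ⊆ α)
    {f : E → E} (hf : IsoMap α β f) :
    ∃ b, IsLine b ∧ b ⊆ β ∧ IsoMap a b f ∧ ∀ X ∈ α, X ∉ a → f X ∉ b := by
  have hfa : IsoMap a β f := hf.mono haα (fun P hP => hf.maps (haα hP))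
  obtain ⟨b, hb, hfb⟩ := hfa.exists_line ha
  obtain ⟨A, hA, B, hB, hAB⟩ := line_two_points a ha
  refine ⟨b, hb, line_subset hb hβ (hfb.ne hA hB hAB) (hfb.maps hA) (hfb.maps hB) (hfa.maps hA)
    (hfa.maps hB), hfb, ?_⟩
  intro X hX hXa h
  obtain ⟨P, hP, e⟩ := hfb.surj_line ha hb h
  exact hf.ne (haα hP) hX (fun e => hXa (e ▸ hP)) e

/-- Extend the inverse of f on a line to a map G of β into α that also inverts f at one further
point. Then f(G Y) and Y have equal distances from three non-collinear points of β. -/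
theorem IsoMap.surj_plane {α β : Set E} (hα : IsPlane α) (hβ : IsPlane β) {f : E → E}
    (hf : IsoMap α β f) : ∀ Y ∈ β, ∃ X ∈ α, f X = Y := by
  intro Y hY
  obtain ⟨a, -, ha, -, -, haα, -⟩ := exists_lines_in_plane hα
  obtain ⟨X, hX, hXa⟩ := exists_mem_plane_notMem_line hα ha
  obtain ⟨b, hb, hbβ, hfb, hni⟩ := hf.line_image hβ ha haα
  obtain ⟨g, hg, hfg, hgf⟩ := hfb.exists_inverse (fun Q hQ => hfb.surj_line ha hb hQ)
  obtain ⟨G, hG, hGg, hGm⟩ := exists_plane_extension hb ha hg hβ hbβ hα haα (hf.maps hX)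
    (hni X hX hXa) hX hXa
  obtain ⟨m1, m2, m3⟩ := hGm (f X) (hf.maps hX) (hni X hX hXa)
  have eX : G (f X) = X := by
    refine (eq_of_d_plane hα ha haα hX hXa (hG.maps (hf.maps hX)) m1
      (fun h => not_opp_self _ (m3.2 h)) ?_).symm
    intro P hP
    have := m2.dist (hfb.maps hP)
    rw [hgf P hP, hf.iso (haα hP) hX] at this
    exact this
  obtain ⟨A, hA, B, hB, hAB⟩ := line_two_points a ha
  have n : ¬ Collinear (f A) (f B) (f X) := not_collinear_of_mem hb (hfb.maps hA) (hfb.maps hB)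
    (hfb.ne hA hB hAB) (hni X hX hXa)
  have key : ∀ P ∈ α, G (f P) = P → d (f P) Y = d (f P) (f (G Y)) := by
    intro P hP e
    rw [hf.iso hP (hG.maps hY), ← hG.iso (hf.maps hP) hY, e]
  have eA : ∀ P ∈ a, G (f P) = P := fun P hP => (hGg _ (hfb.maps hP)).trans (hgf P hP)
  exact ⟨G Y, hG.maps hY, (eq_of_d_three hβ n (hf.maps (haα hA)) (hf.maps (haα hB)) (hf.maps hX) hY
    (key A (haα hA) (eA A hA)) (key B (haα hB) (eA B hB)) (key X hX eX)).symm⟩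

/-! ### Congruent mappings of the space -/

/-- On a given side of a plane, a point is determined by its distances from the points of the
plane. -/
theorem eq_of_d_space {α : Set E} (hα : IsPlane α) {X Y : E} (hX : X ∉ α) (hY : Y ∉ α)
    (ho : ¬ Opp α X Y) (h : ∀ P ∈ α, d P X = d P Y) : X = Y := by
  by_contra hXY
  obtain ⟨l, hl, hXl, hYl⟩ := exists_line hXY
  obtain ⟨a, -, ha, -, -, haα, -⟩ := exists_lines_in_plane hα
  obtain ⟨P, hP, hPl⟩ : ∃ P ∈ α, P ∉ l := by
    obtain ⟨A, hA, B, hB, hAB⟩ := line_two_points a ha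
    by_cases hAl : A ∈ l
    · exact ⟨B, haα hB, fun hBl =>
        hAB ((flat_plane hα).unique hl hXl hX hAl (haα hA) hBl (haα hB))⟩
    · exact ⟨A, haα hA, hAl⟩
  -- This plane contains X and Y and meets α in a line, so the planar uniqueness applies.
  obtain ⟨γ, hγ, hlγ, hPγ⟩ := exists_plane_line hl hPl
  have hne : α ≠ γ := by rintro rfl; exact hX (hlγ hXl)
  obtain ⟨b, hb, -, hbα, hbγ, -⟩ := exists_inter_line hα hγ hne hP hPγ
  exact hXY (eq_of_d_plane hγ hb hbγ (hlγ hXl) (fun h => hX (hbα h)) (hlγ hYl)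
    (fun h => hY (hbα h)) (fun ⟨Q, hQ, h⟩ => ho ⟨Q, hbα hQ, h⟩) (fun P hP => h P (hbα hP)))

/-- The foot `K` of the perpendicular from `X` to a line: there are two points of the line
symmetric with respect to `K` and equidistant from `X`. -/
theorem exists_foot {a : Set E} (ha : IsLine a) {X : E} (hX : X ∉ a) :
    ∃ K ∈ a, ∃ A ∈ a, ∃ B ∈ a, Btw A K B ∧ d K A = d K B ∧ d A X = d B X := by
  obtain ⟨γ, hγ, haγ, hXγ⟩ := exists_plane_line ha hX
  obtain ⟨O, hO, -⟩ := line_two_points a ha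
  obtain ⟨Y, hY, hYa, hXY⟩ := exists_opp (flat_plane hγ) (flat_line ha) (haγ hO) hO hXγ hX
  obtain ⟨W, hW, hWa, hYW, hm⟩ := exists_match ha ha (isoMap_id a) hγ haγ hX hY hYa
  obtain ⟨K, hK, hXKW⟩ : Opp a X W :=
    ((separates_line hγ ha haγ).opp hXγ hY hW hX hYa hWa hXY).2 hYW
  obtain ⟨A, hA, hAK⟩ := exists_ne_mem ha K
  obtain ⟨B, hB, hd⟩ := exists_btw_d hAK hAK.symm
  refine ⟨K, hK, A, hA, B, hB.mem_right ha hA hK, hB, hd.symm, ?_⟩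
  have n := not_collinear_of_mem ha hA hK hAK hX
  have n' : ¬ Collinear X K A := fun h => n (collinear_rev h)
  -- Vertical angles at K: with W the mirror image of X, the triangles BKX and AKW are congruent, so
  -- BX = AW = AX.
  have v := supplement n n' (by rw [angle_comm X]; exact angCong_refl A K X n) hB hXKW
  rw [angle_comm W] at v
  exact (hm.dist hA).trans (sas (not_collinear_of_btw n hB)
    (fun h => not_collinear_of_btw n' hXKW (collinear_rev h)) hd (hm.dist hK) v).symm

/-- A perpendicular plane replaces the angle. Let γ consist of points equidistant from f(A) and
f(B), where A, B are symmetric about the foot K of X on a line a of α. Matching X inside γ along the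
line KN gives the right distances from K and N; the symmetry of γ is used to obtain the distance
from A. -/
theorem exists_match_space {α β : Set E} (hα : IsPlane α) (hβ : IsPlane β) {f : E → E}
    (hf : IsoMap α β f) {X Y : E} (hX : X ∉ α) (hY : Y ∉ β) :
    ∃ X', X' ∉ β ∧ ¬ Opp β Y X' ∧ ∀ P ∈ α, d P X = d (f P) X' := by
  obtain ⟨a, -, ha, -, -, haα, -⟩ := exists_lines_in_plane hα
  have hXa : X ∉ a := fun h => hX (haα h)
  obtain ⟨K, hK, A, hA, B, hB, hAKB, dK, dX⟩ := exists_foot ha hXa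
  obtain ⟨a', ha', haβ, hfa, hni⟩ := hf.line_image hβ ha haα
  obtain ⟨N₀, hN₀, hN₀a⟩ := exists_mem_plane_notMem_line hα ha
  -- N is X turned about a into α, and V below is X turned into the plane through a' and Y; both
  -- inherit equidistance from the two symmetric points.
  obtain ⟨N, hN, hNa, -, mN⟩ := exists_match ha ha (isoMap_id a) hα haα hXa hN₀ hN₀a
  have dN : d N A = d N B := by
    rw [d_comm, d_comm N]
    exact (mN.dist hA).symm.trans (dX.trans (mN.dist hB))
  obtain ⟨δ, hδ, haδ, hYδ⟩ := exists_plane_line ha' (fun h => hY (haβ h))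
  obtain ⟨V, hV, hVa, -, mV⟩ := exists_match ha ha' hfa hδ haδ hXa hYδ (fun h => hY (haβ h))
  have hVβ : V ∉ β := fun h => hY (plane_ext_line ha' hδ hβ hVa haδ haβ hV h ▸ hYδ)
  have dV : d V (f A) = d V (f B) := by
    rw [d_comm, d_comm V]
    exact (mV.dist hA).symm.trans (dX.trans (mV.dist hB))
  have hKN : K ≠ N := fun h => hNa (h ▸ hK)
  obtain ⟨k, hk, hKk, hNk⟩ := exists_line hKN
  have hkα := line_subset hk hα hKN hKk hNk (haα hK) hN
  obtain ⟨k', hk', hkβ, hfk, -⟩ := hf.line_image hβ hk hkα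
  obtain ⟨γ, hγ, hkγ, hVγ⟩ := exists_plane_line hk' (fun h => hVβ (hkβ h))
  have hγE : γ ⊆ {P : E | d P (f A) = d P (f B)} := by
    refine (flat_equidistant (f A) (f B)).plane_subset hγ (not_collinear_of_mem hk' (hfk.maps hKk)
      (hfk.maps hNk) (hfk.ne hKk hNk hKN) (fun h => hVβ (hkβ h))) (hkγ (hfk.maps hKk))
      (hkγ (hfk.maps hNk)) hVγ ?_ ?_ dV
    · exact (hfa.iso hK hA).trans (dK.trans (hfa.iso hK hB).symm)
    · exact (hf.iso hN (haα hA)).trans (dN.trans (hf.iso hN (haα hB)).symm)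
  have sβ := separates_plane hβ
  obtain ⟨Y₁, hY₁, hY₁β, hYY⟩ : ∃ Y₁ ∈ γ, Y₁ ∉ β ∧ ¬ Opp β Y Y₁ := by
    by_cases ho : Opp β Y V
    · obtain ⟨Z, hZ, hZβ, hVZ⟩ := exists_opp (flat_plane hγ) (flat_plane hβ)
        (hkγ (hfk.maps hKk)) (hkβ (hfk.maps hKk)) hVγ hVβ
      exact ⟨Z, hZ, hZβ, sβ.two trivial trivial trivial hY hVβ hZβ ho hVZ⟩
    · exact ⟨V, hVγ, hVβ, ho⟩
  obtain ⟨X', hX', hXk', ho, mX⟩ := exists_match hk hk' hfk hγ hkγ (fun h => hX (hkα h)) hY₁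
    (fun h => hY₁β (hkβ h))
  have hγβ : ∀ P ∈ γ, P ∈ β → P ∈ k' := by
    intro P h1 h2
    by_contra h3
    exact hVβ (plane_ext_line hk' hγ hβ h3 hkγ hkβ h1 h2 ▸ hVγ)
  have hXβ : X' ∉ β := fun h => hXk' (hγβ X' hX' h)
  have hXa' : X' ∉ a' := fun h => hXβ (haβ h)
  refine ⟨X', hXβ, ?_, ?_⟩
  · refine (sβ.same trivial trivial trivial hY hY₁β hXβ hYY).not.2 ?_
    rintro ⟨R, hR, h⟩
    exact ho ⟨R, hγβ R ((flat_plane hγ).mem_mid h hY₁ hX') hR, h⟩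
  obtain ⟨ε, hε, haε, hXε⟩ := exists_plane_line ha' hXa'
  -- Z has the right distances from a' by construction, so it remains to show Z = X'. If f(K), X', Z
  -- were not collinear, all of their plane would be equidistant from f(A) and f(B), including f(A)
  -- itself.
  obtain ⟨Z, hZ, hZa, hXZ, mZ⟩ := exists_match ha ha' hfa hε haε hXa hXε hXa'
  have hc : Collinear (f K) X' Z := by
    by_contra hn
    refine hfa.ne hA hB hAKB.ne.2.2 (eq_of_d_three hε hn (haε (hfa.maps hK)) hXε hZ
      (haε (hfa.maps hA)) (hγE (hkγ (hfk.maps hKk))) (hγE hX') ?_)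
    rw [d_comm, d_comm Z]
    exact (mZ.dist hA).symm.trans (dX.trans (mZ.dist hB))
  have e : Z = X' := by
    obtain ⟨m, hm, m1, m2, m3⟩ := hc
    have hKX : f K ≠ X' := fun h => hXa' (h ▸ hfa.maps hK)
    rcases mem_ray_or_btw hm m1 m2 m3 hKX with h | h
    · exact eq_of_d_ray hKX h (mem_ray_self _ _) ((mZ.dist hK).symm.trans (mX.dist hKk))
    · exact absurd ⟨f K, hfa.maps hK, h⟩ hXZ
  subst e
  exact hf.d_of_three hα (not_collinear_of_mem ha hA hK hAKB.ne.1 hNa) (haα hA) (haα hK) hN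
    (mZ.dist hA) (mX.dist hKk) (mX.dist hNk)

section

variable {α β : Set E} {f : E → E}

/-- The five segments property along XOW with apex P, in place of the supplementary angles of the
planar case. -/
theorem d_space_of_btw (hf : IsoMap α β f) {X X' O W W' : E} (h : ∀ P ∈ α, d P X = d (f P) X')
    (hO : O ∈ α) (h1 : Btw X O W) (h2 : Btw X' (f O) W') (hd : d (f O) W' = d O W) :
    ∀ P ∈ α, d P W = d (f P) W' := by
  intro P hP
  obtain ⟨l, hl, l1, l2, l3⟩ := h1.col
  have e : d X O = d X' (f O) := by rw [d_comm, h O hO, d_comm]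
  rw [d_comm, d_comm (f P)]
  refine five_segment hl l1 l2 l3 h1.ne.1 e (d_add h1 h2 e hd.symm) hd.symm ?_ (hf.iso hO hP).symm
  rw [d_comm, h P hP, d_comm]

theorem d_space_opp (hβ : IsPlane β) (hf : IsoMap α β f) {X X' Y Y' : E}
    (hXβ : X' ∉ β) (hYβ : Y' ∉ β) (ho : Opp α X Y)
    (ho' : Opp β X' Y') (h1 : ∀ P ∈ α, d P X = d (f P) X') (h2 : ∀ P ∈ α, d P Y = d (f P) Y')
    (hs : ∀ Q ∈ β, ∃ P ∈ α, f P = Q) : d X' Y' = d X Y := by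
  obtain ⟨Q, hQ, h⟩ := ho
  have hQβ := hf.maps hQ
  obtain ⟨Z, hZ, hd⟩ := exists_btw_d (fun e => hXβ (e ▸ hQβ) : X' ≠ f Q) h.ne.2.1
  have h3 := d_space_of_btw hf h1 hQ h hZ hd
  have hZβ : Z ∉ β := fun h => hXβ ((flat_plane hβ).mem_left hZ hQβ h)
  have e : Z = Y' := by
    refine eq_of_d_space hβ hZβ hYβ (((separates_plane hβ).opp trivial trivial trivial hXβ hZβ hYβ
      ⟨f Q, hQβ, hZ⟩).1 ho') ?_
    intro R hR
    obtain ⟨P, hP, rfl⟩ := hs R hR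
    exact (h3 P hP).symm.trans (h2 P hP)
  subst e
  exact d_add hZ h (by rw [d_comm, ← h1 Q hQ, d_comm]) hd

/-- Prolong XO to W on the other side: the separated case gives WY, and the five segments property
along WOX with apex Y gives XY. -/
theorem d_space_same (hα : IsPlane α) (hβ : IsPlane β) (hf : IsoMap α β f) {X X' Y Y' : E}
    (hX : X ∉ α) (hY : Y ∉ α) (hXβ : X' ∉ β) (hYβ : Y' ∉ β) (ho : ¬ Opp α X Y)
    (ho' : ¬ Opp β X' Y') (h1 : ∀ P ∈ α, d P X = d (f P) X') (h2 : ∀ P ∈ α, d P Y = d (f P) Y')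
    (hs : ∀ Q ∈ β, ∃ P ∈ α, f P = Q) : d X' Y' = d X Y := by
  obtain ⟨O, hO⟩ := plane_nonempty α hα
  have hOβ := hf.maps hO
  obtain ⟨W, hW⟩ := btw_extend X O (fun h => hX (h ▸ hO))
  obtain ⟨W', hW', hd⟩ := exists_btw_d (fun e => hXβ (e ▸ hOβ) : X' ≠ f O) hW.ne.2.1
  have h3 := d_space_of_btw hf h1 hO hW hW' hd
  have hWα : W ∉ α := fun h => hX ((flat_plane hα).mem_left hW hO h)
  have hWβ : W' ∉ β := fun h => hXβ ((flat_plane hβ).mem_left hW' hOβ h)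
  have o1 : Opp α W Y := by
    rw [opp_comm, ← (separates_plane hα).same trivial trivial trivial hX hY hWα ho]
    exact ⟨O, hO, hW⟩
  have o2 : Opp β W' Y' := by
    rw [opp_comm, ← (separates_plane hβ).same trivial trivial trivial hXβ hYβ hWβ ho']
    exact ⟨f O, hOβ, hW'⟩
  have e := d_space_opp hβ hf hWβ hYβ o1 o2 h3 h2 hs
  obtain ⟨l, hl, l1, l2, l3⟩ := hW.symm.col
  have e1 : d W O = d W' (f O) := by rw [d_comm, ← hd, d_comm]
  exact (five_segment hl l1 l2 l3 hW.symm.ne.1 e1 (d_add hW.symm hW'.symm e1 (h1 O hO)) (h1 O hO)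
    e.symm (h2 O hO)).symm

/-- The extension of a congruent mapping from a plane to the space. -/
theorem exists_space_extension (hα : IsPlane α) (hβ : IsPlane β) (hf : IsoMap α β f) {X₀ Y₀ : E}
    (hX₀ : X₀ ∉ α) (hY₀ : Y₀ ∉ β) :
    ∃ F : E → E, IsoMap Set.univ Set.univ F ∧ (∀ P ∈ α, F P = f P) ∧
      (∀ X, X ∉ α → F X ∉ β ∧ (Opp α X₀ X ↔ Opp β Y₀ (F X))) ∧ ∀ Y, ∃ X, F X = Y := by
  have sα := separates_plane hα
  have sβ := separates_plane hβ
  have hs := hf.surj_plane hα hβ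
  -- Stated for arbitrary planes so that it also applies to the inverse of f, which provides
  -- preimages.
  have key : ∀ {α β : Set E} {f : E → E} {X₀ Y₀ : E}, IsPlane α → IsPlane β → IsoMap α β f →
      Y₀ ∉ β → ∀ X : E, ∃ X' : E, (X ∈ α → X' = f X) ∧ (X ∉ α →
      X' ∉ β ∧ (∀ P ∈ α, d P X = d (f P) X') ∧ (Opp α X₀ X ↔ Opp β Y₀ X')) := by
    intro α β f X₀ Y₀ hα hβ hf hY₀ X
    obtain ⟨O, hO⟩ := plane_nonempty β hβ
    obtain ⟨Y₁, -, hY₁, ho⟩ := exists_opp (fun _ _ _ _ _ _ _ _ _ => Set.subset_univ _)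
      (flat_plane hβ) trivial hO trivial hY₀
    by_cases hX : X ∈ α
    · exact ⟨f X, fun _ => rfl, fun h => absurd hX h⟩
    by_cases hXX : Opp α X₀ X
    · obtain ⟨X', h1, h2, h3⟩ := exists_match_space hα hβ hf hX hY₁
      exact ⟨X', fun h => absurd h hX, fun _ => ⟨h1, h3, iff_of_true hXX
        (((separates_plane hβ).opp trivial trivial trivial hY₀ hY₁ h1 ho).2 h2)⟩⟩
    · obtain ⟨X', h1, h2, h3⟩ := exists_match_space hα hβ hf hX hY₀
      exact ⟨X', fun h => absurd h hX, fun _ => ⟨h1, h3, iff_of_false hXX h2⟩⟩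
  choose F hF1 hF2 using key (X₀ := X₀) hα hβ hf hY₀
  refine ⟨F, ⟨fun _ => trivial, ?_⟩, hF1, fun X hX => ⟨(hF2 X hX).1, (hF2 X hX).2.2⟩, ?_⟩
  · intro X Y _ _
    by_cases hXα : X ∈ α
    · rw [hF1 X hXα]
      by_cases hYα : Y ∈ α
      · rw [hF1 Y hYα]
        exact hf.iso hXα hYα
      · exact ((hF2 Y hYα).2.1 X hXα).symm
    · obtain ⟨h1, h2, h3⟩ := hF2 X hXα
      by_cases hYα : Y ∈ α
      · rw [hF1 Y hYα, d_comm, d_comm X]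
        exact (h2 Y hYα).symm
      · obtain ⟨k1, k2, k3⟩ := hF2 Y hYα
        have hiff : Opp α X Y ↔ Opp β (F X) (F Y) := by
          by_cases hXX : Opp α X₀ X
          · have e1 := sα.opp trivial trivial trivial hX₀ hXα hYα hXX
            have e2 := sβ.opp trivial trivial trivial hY₀ h1 k1 (h3.1 hXX)
            tauto
          · have e1 := sα.same trivial trivial trivial hX₀ hXα hYα hXX
            have e2 := sβ.same trivial trivial trivial hY₀ h1 k1 (fun h => hXX (h3.2 h))
            tauto
        by_cases hXY : Opp α X Y
        · exact d_space_opp hβ hf h1 k1 hXY (hiff.1 hXY) h2 k2 hs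
        · exact d_space_same hα hβ hf hXα hYα h1 k1 hXY (fun h => hXY (hiff.2 h)) h2 k2 hs
  · intro Y
    by_cases hY : Y ∈ β
    · obtain ⟨X, hX, e⟩ := hs Y hY
      exact ⟨X, (hF1 X hX).trans e⟩
    obtain ⟨g, hg, hfg, hgf⟩ := hf.exists_inverse hs
    obtain ⟨X, -, hX⟩ := key (X₀ := Y₀) hβ hα hg hX₀ Y
    obtain ⟨h1, h2, h3⟩ := hX hY
    obtain ⟨k1, k2, k3⟩ := hF2 X h1
    refine ⟨X, eq_of_d_space hβ k1 hY ?_ ?_⟩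
    · by_cases ho : Opp β Y₀ Y
      · exact (sβ.opp trivial trivial trivial hY₀ k1 hY (k3.1 (h3.1 ho))).1 ho
      · exact (sβ.same trivial trivial trivial hY₀ k1 hY
          (fun h => ho (h3.2 (k3.2 h)))).not.1 ho
    · intro P hP
      have := k2 (g P) (hg.maps hP)
      rw [hfg P hP] at this
      rw [← this]
      exact (h2 P hP).symm

end

/-! ### Congruent translations -/

/-- Passing to maps on all of E avoids subtypes; the values outside S are irrelevant. -/
theorem IsCongruentTranslation.exists_isoMap {S T : Set E} {f : S → T}
    (hf : IsCongruentTranslation f) : ∃ g : E → E, IsoMap S T g ∧ ∀ X : S, g X = f X := by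
  classical
  refine ⟨fun X => if h : X ∈ S then f ⟨X, h⟩ else X, ⟨?_, ?_⟩, fun X => by simp⟩
  · intro P hP
    simp [hP]
  · intro P Q hP hQ
    simp only [hP, hQ, dite_true]
    by_cases h : P = Q
    · subst h
      exact d_self _ _
    · obtain ⟨h1, h2⟩ := hf ⟨P, hP⟩ ⟨Q, hQ⟩ (fun e => h (congrArg Subtype.val e))
      exact d_of_segCong (fun e => h1 (Subtype.ext e)) h h2

theorem IsoMap.isCongruentTranslation {S T : Set E} {f : E → E} (hf : IsoMap S T f) :
    IsCongruentTranslation (fun X : S => (⟨f X, hf.maps X.2⟩ : T)) := by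
  intro X Y h
  have h' := hf.ne X.2 Y.2 (fun e => h (Subtype.ext e))
  exact ⟨fun e => h' (congrArg Subtype.val e), segCong_of_d (hf.iso X.2 Y.2) h'⟩

theorem isSpaceCongruentTranslation_iff {F : E → E} :
    IsSpaceCongruentTranslation F ↔ IsoMap Set.univ Set.univ F := by
  constructor
  · refine fun h => ⟨fun _ => trivial, ?_⟩
    intro P Q _ _
    by_cases e : P = Q
    · subst e
      exact d_self _ _
    · exact d_of_segCong (h P Q e).1 e (h P Q e).2
  · intro h X Y e
    have h' := h.ne (P := X) (Q := Y) trivial trivial e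
    exact ⟨h', segCong_of_d (h.iso trivial trivial) h'⟩

theorem IsHalfPlane.exists_sides {α a H K : Set E} (hα : IsPlane α) (ha : IsLine a) (haα : a ⊆ α)
    (hH : IsHalfPlane α a H) (hK : IsHalfPlane α a K) (hne : H ≠ K) :
    ∃ A ∈ α, A ∉ a ∧ H = {X | X ∈ α ∧ X ∉ a ∧ ¬ Opp a A X} ∧
      K = {X | X ∈ α ∧ X ∉ a ∧ Opp a A X} := by
  obtain ⟨A, hA, hAa, rfl⟩ := hH
  obtain ⟨B, hB, hBa, rfl⟩ := hK
  rw [halfPlaneOf_eq hAa, halfPlaneOf_eq hBa] at hne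
  rw [halfPlaneOf_eq hAa, halfPlaneOf_eq hBa]
  exact ⟨A, hA, hAa, rfl, (separates_line hα ha haα).mem_other hA hB hAa hBa hne⟩

theorem IsHalfSpace.exists_sides {α H K : Set E} (hα : IsPlane α)
    (hH : IsHalfSpace α H) (hK : IsHalfSpace α K) (hne : H ≠ K) :
    ∃ A, A ∉ α ∧ H = {X | X ∉ α ∧ ¬ Opp α A X} ∧ K = {X | X ∉ α ∧ Opp α A X} := by
  obtain ⟨A, hA, rfl⟩ := hH
  obtain ⟨B, hB, rfl⟩ := hK
  rw [halfSpaceOf_eq hA, halfSpaceOf_eq hB] at hne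
  rw [halfSpaceOf_eq hA, halfSpaceOf_eq hB]
  refine ⟨A, hA, ?_, ?_⟩
  · ext X; simp [sideOf]
  · rw [(separates_plane hα).mem_other trivial trivial hA hB hne]
    ext X; simp

theorem existsUnique_plane_extension {α β a b aPlus aMinus bPlus bMinus : Set E}
    (hα : IsPlane α) (hβ : IsPlane β) (ha : IsLine a) (hb : IsLine b) (haα : a ⊆ α) (hbβ : b ⊆ β)
    (h1 : IsHalfPlane α a aPlus) (h2 : IsHalfPlane α a aMinus) (h12 : aPlus ≠ aMinus)
    (h3 : IsHalfPlane β b bPlus) (h4 : IsHalfPlane β b bMinus) (h34 : bPlus ≠ bMinus)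
    (f : a → b) (hf : IsCongruentTranslation f) :
    ∃! F : α → β, IsCongruentTranslation F ∧
      (∀ (X : α) (hX : (X : E) ∈ a), (F X : E) = f ⟨X, hX⟩) ∧
      imageOf F aPlus = bPlus ∧ imageOf F aMinus = bMinus := by
  obtain ⟨A, hA, hAa, rfl, rfl⟩ := IsHalfPlane.exists_sides hα ha haα h1 h2 h12
  obtain ⟨B, hB, hBb, rfl, rfl⟩ := IsHalfPlane.exists_sides hβ hb hbβ h3 h4 h34
  obtain ⟨f', hf', ef⟩ := hf.exists_isoMap
  obtain ⟨F, hF, hFf, hFm⟩ := exists_plane_extension ha hb hf' hα haα hβ hbβ hA hAa hB hBb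
  have hs := hF.surj_plane hα hβ
  have hnb : ∀ X ∈ α, F X ∉ b → X ∉ a := fun X _ h h' => h (hFf X h' ▸ hf'.maps h')
  refine ⟨fun X => ⟨F X, hF.maps X.2⟩, ⟨hF.isCongruentTranslation, ?_, ?_, ?_⟩, ?_⟩
  · intro X hX
    exact (hFf X hX).trans (ef ⟨X, hX⟩)
  · ext Y
    constructor
    · rintro ⟨X, ⟨x1, x2, x3⟩, rfl⟩
      exact ⟨hF.maps x1, (hFm X x1 x2).1, fun h => x3 ((hFm X x1 x2).2.2.2 h)⟩
    · rintro ⟨y1, y2, y3⟩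
      obtain ⟨X, hX, rfl⟩ := hs Y y1
      have hXa := hnb X hX y2
      exact ⟨⟨X, hX⟩, ⟨hX, hXa, fun h => y3 ((hFm X hX hXa).2.2.1 h)⟩, rfl⟩
  · ext Y
    constructor
    · rintro ⟨X, ⟨x1, x2, x3⟩, rfl⟩
      exact ⟨hF.maps x1, (hFm X x1 x2).1, (hFm X x1 x2).2.2.1 x3⟩
    · rintro ⟨y1, y2, y3⟩
      obtain ⟨X, hX, rfl⟩ := hs Y y1
      have hXa := hnb X hX y2
      exact ⟨⟨X, hX⟩, ⟨hX, hXa, (hFm X hX hXa).2.2.2 y3⟩, rfl⟩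
  · rintro G ⟨hG, hGf, hp, hm⟩
    obtain ⟨G', hG', eG⟩ := hG.exists_isoMap
    funext X
    apply Subtype.ext
    change (G X : E) = F X
    have eGa : ∀ P ∈ a, G' P = f' P := by
      intro P hP
      rw [eG ⟨P, haα hP⟩, hGf ⟨P, haα hP⟩ hP, ← ef ⟨P, hP⟩]
    by_cases hX : (X : E) ∈ a
    · rw [← eG X, eGa X hX, hFf X hX]
    -- Every point of b is an image under f, so two extensions of f give X images with equal
    -- distances from b; their common side then makes them equal.
    have hdist : ∀ Q ∈ b, d Q (G X) = d Q (F X) := by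
      intro Q hQ
      obtain ⟨P, hP, rfl⟩ := hf'.surj_line ha hb hQ
      rw [← eG X, ← eGa P hP, hG'.iso (haα hP) X.2, eGa P hP, ← hFf P hP, hF.iso (haα hP) X.2]
    obtain ⟨m1, -, m3⟩ := hFm X X.2 hX
    by_cases ho : Opp a A X
    · have hGX : (G X : E) ∈ {Y | Y ∈ β ∧ Y ∉ b ∧ Opp b B Y} :=
        hm ▸ ⟨X, ⟨X.2, hX, ho⟩, rfl⟩
      exact eq_of_d_plane hβ hb hbβ hGX.1 hGX.2.1 (hF.maps X.2) m1
        (((separates_line hβ hb hbβ).opp hB hGX.1 (hF.maps X.2) hBb hGX.2.1 m1 hGX.2.2).1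
          (m3.1 ho)) hdist
    · have hGX : (G X : E) ∈ {Y | Y ∈ β ∧ Y ∉ b ∧ ¬ Opp b B Y} :=
        hp ▸ ⟨X, ⟨X.2, hX, ho⟩, rfl⟩
      exact eq_of_d_plane hβ hb hbβ hGX.1 hGX.2.1 (hF.maps X.2) m1
        (((separates_line hβ hb hbβ).same hB hGX.1 (hF.maps X.2) hBb hGX.2.1 m1 hGX.2.2).not.1
          (fun h => ho (m3.2 h))) hdist

theorem existsUnique_space_extension {α β αPlus αMinus βPlus βMinus : Set E}
    (hα : IsPlane α) (hβ : IsPlane β)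
    (h1 : IsHalfSpace α αPlus) (h2 : IsHalfSpace α αMinus) (h12 : αPlus ≠ αMinus)
    (h3 : IsHalfSpace β βPlus) (h4 : IsHalfSpace β βMinus) (h34 : βPlus ≠ βMinus)
    (f : α → β) (hf : IsCongruentTranslation f) :
    ∃! F : E → E, IsSpaceCongruentTranslation F ∧ (∀ X : α, F X = f X) ∧
      F '' αPlus = βPlus ∧ F '' αMinus = βMinus := by
  obtain ⟨A, hA, rfl, rfl⟩ := IsHalfSpace.exists_sides hα h1 h2 h12
  obtain ⟨B, hB, rfl, rfl⟩ := IsHalfSpace.exists_sides hβ h3 h4 h34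
  obtain ⟨f', hf', ef⟩ := hf.exists_isoMap
  obtain ⟨F, hF, hFf, hFm, hs⟩ := exists_space_extension hα hβ hf' hA hB
  have hnb : ∀ X, F X ∉ β → X ∉ α := fun X h h' => h (hFf X h' ▸ hf'.maps h')
  refine ⟨F, ⟨isSpaceCongruentTranslation_iff.2 hF, ?_, ?_, ?_⟩, ?_⟩
  · intro X
    exact (hFf X X.2).trans (ef X)
  · ext Y
    constructor
    · rintro ⟨X, ⟨x2, x3⟩, rfl⟩
      exact ⟨(hFm X x2).1, fun h => x3 ((hFm X x2).2.2 h)⟩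
    · rintro ⟨y2, y3⟩
      obtain ⟨X, rfl⟩ := hs Y
      have hXa := hnb X y2
      exact ⟨X, ⟨hXa, fun h => y3 ((hFm X hXa).2.1 h)⟩, rfl⟩
  · ext Y
    constructor
    · rintro ⟨X, ⟨x2, x3⟩, rfl⟩
      exact ⟨(hFm X x2).1, (hFm X x2).2.1 x3⟩
    · rintro ⟨y2, y3⟩
      obtain ⟨X, rfl⟩ := hs Y
      have hXa := hnb X y2
      exact ⟨X, ⟨hXa, (hFm X hXa).2.2 y3⟩, rfl⟩
  · rintro G ⟨hG, hGf, hp, hm⟩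
    have hG' := isSpaceCongruentTranslation_iff.1 hG
    funext X
    have eGa : ∀ P ∈ α, G P = F P := by
      intro P hP
      rw [hGf ⟨P, hP⟩, hFf P hP, ← ef ⟨P, hP⟩]
    by_cases hX : X ∈ α
    · exact eGa X hX
    -- As in the planar case, now using that f maps α onto β.
    have hdist : ∀ Q ∈ β, d Q (G X) = d Q (F X) := by
      intro Q hQ
      obtain ⟨P, hP, rfl⟩ := hf'.surj_plane hα hβ Q hQ
      rw [← hFf P hP, hF.iso trivial trivial, ← eGa P hP, hG'.iso trivial trivial]
    obtain ⟨m1, m3⟩ := hFm X hX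
    have sβ := separates_plane hβ
    by_cases ho : Opp α A X
    · have hGX : G X ∈ {Y | Y ∉ β ∧ Opp β B Y} := hm ▸ ⟨X, ⟨hX, ho⟩, rfl⟩
      exact eq_of_d_space hβ hGX.1 m1
        ((sβ.opp trivial trivial trivial hB hGX.1 m1 hGX.2).1 (m3.1 ho)) hdist
    · have hGX : G X ∈ {Y | Y ∉ β ∧ ¬ Opp β B Y} := hp ▸ ⟨X, ⟨hX, ho⟩, rfl⟩
      exact eq_of_d_space hβ hGX.1 m1
        ((sβ.same trivial trivial trivial hB hGX.1 m1 hGX.2).not.1 (fun h => ho (m3.2 h))) hdist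

end AbsoluteSpace

theorem theorem5p4 {E : Type*} [AbsoluteSpace E] :
    -- extension from a line to a plane
    (∀ (α β a b aPlus aMinus bPlus bMinus : Set E),
      SpacePrimitives.IsPlane α → SpacePrimitives.IsPlane β →
      SpacePrimitives.IsLine a → SpacePrimitives.IsLine b → a ⊆ α → b ⊆ β →
      SpacePrimitives.IsHalfPlane α a aPlus → SpacePrimitives.IsHalfPlane α a aMinus →
      aPlus ≠ aMinus →
      SpacePrimitives.IsHalfPlane β b bPlus → SpacePrimitives.IsHalfPlane β b bMinus →
      bPlus ≠ bMinus →
      ∀ f : a → b, AbsoluteSpace.IsCongruentTranslation f →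
        ∃! F : α → β, AbsoluteSpace.IsCongruentTranslation F ∧
          (∀ (X : α) (hX : (X : E) ∈ a), (F X : E) = f ⟨X, hX⟩) ∧
          AbsoluteSpace.imageOf F aPlus = bPlus ∧
          AbsoluteSpace.imageOf F aMinus = bMinus) ∧
    -- extension from a plane to the space
    (∀ (α β αPlus αMinus βPlus βMinus : Set E),
      SpacePrimitives.IsPlane α → SpacePrimitives.IsPlane β →
      SpacePrimitives.IsHalfSpace α αPlus → SpacePrimitives.IsHalfSpace α αMinus →
      αPlus ≠ αMinus →
      SpacePrimitives.IsHalfSpace β βPlus → SpacePrimitives.IsHalfSpace β βMinus →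
      βPlus ≠ βMinus →
      ∀ f : α → β, AbsoluteSpace.IsCongruentTranslation f →
        ∃! F : E → E, AbsoluteSpace.IsSpaceCongruentTranslation F ∧
          (∀ X : α, F X = f X) ∧
          F '' αPlus = βPlus ∧ F '' αMinus = βMinus) :=
  ⟨fun _ _ _ _ _ _ _ _ hα hβ ha hb haα hbβ h1 h2 h12 h3 h4 h34 f hf =>
    AbsoluteSpace.existsUnique_plane_extension hα hβ ha hb haα hbβ h1 h2 h12 h3 h4 h34 f hf,
  fun _ _ _ _ _ _ hα hβ h1 h2 h12 h3 h4 h34 f hf =>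
    AbsoluteSpace.existsUnique_space_extension hα hβ h1 h2 h12 h3 h4 h34 f hf⟩
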